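/- The LOCAL model. The network is a finite simple graph $G$ with $n$ vertices, which carry distinct identifiers from $\{1,\dots,n\}$. All vertices run the same deterministic algorithm. Initially each vertex knows $n$, its own identifier and its own input. In each synchronous round, every vertex sends messages to its neighbours, receives the messages of its neighbours, and updates its state; messages and local computations are unbounded. At some point each vertex irrevocably chooses an output (it may still relay messages afterwards). The number of rounds of an execution is the number of rounds until every vertex has chosen its output. The maximum average degree $\mathrm{mad}(G)$ is the maximum of $2|E(H)|/|V(H)|$ over all subgraphs $H$ of $G$ (where the quotient is read as $0$ if $H$ has no vertices). Theorem. There is an absolute constant $K$ such that for every set $C$ of colors there is a deterministic algorithm in the LOCAL model, in which the input of a vertex $v$ is a pair $(d,L(v))$, with the following property. Let $G$ be a graph on $n$ vertices with any assignment of distinct identifiers from $\{1,\dots,n\}$, let $d\ge\max(3,\mathrm{mad}(G))$ be an integer, and let $(L(v))_{v\in V(G)}$ be finite subsets of $C$ with $|L(v)|\ge d$ for every vertex $v$. Then every vertex chooses an output, and either 1. at least one vertex outputs a clique, and every vertex that does so outputs the set of identifiers of the vertices of a clique of $G$ on $d+1$ vertices that contains it; or 2. every vertex $v$ outputs a color $c(v)\in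 L(v)$, and $c(u)\ne c(v)$ for every edge $uv$ of $G$. The number of rounds is at most $K\,d^4\log^3 n$. Moreover, if every vertex of $G$ has degree at most $d$, then the number of rounds of the same algorithm is at most $K\,d^2\log^3 n$. -/

import Mathlib

universe u v

/-- The average degree `2 |E(H)| / |V(H)|` of a (finite) subgraph `H` of `G`. It is `0` for the
subgraph without vertices, by the convention `x / 0 = 0`. -/
noncomputable def averageDegree {V : Type v} {G : SimpleGraph V} (H : G.Subgraph) : ℝ :=
  2 * (H.edgeSet.ncard : ℝ) / (H.verts.ncard : ℝ)

/-- The maximum average degree of `G`: the maximum of the average degrees of its subgraphs.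
A finite graph has finitely many subgraphs and at least one, so the supremum is a maximum
(see `exists_averageDegree_eq_mad` and `averageDegree_le_mad`). -/
noncomputable def mad {V : Type v} [Finite V] (G : SimpleGraph V) : ℝ :=
  ⨆ H : G.Subgraph, averageDegree H

theorem averageDegree_le_mad {V : Type v} [Finite V] (G : SimpleGraph V) (H : G.Subgraph) :
    averageDegree H ≤ mad G :=
  le_ciSup (f := fun H : G.Subgraph => averageDegree H) (Set.finite_range _).bddAbove H

theorem exists_averageDegree_eq_mad {V : Type v} [Finite V] (G : SimpleGraph V) :
    ∃ H : G.Subgraph, averageDegree H = mad G :=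
  exists_eq_ciSup_of_finite

/-- A deterministic algorithm in the `LOCAL` model of distributed computing, where every vertex
has a local input in `I` and has to choose a local output in `O`.

All vertices run the same code. A vertex starts in the state `init n i x`, where `n` is the number
of vertices of the network, `i` is its own identifier and `x` is its own input. In every
synchronous round it sends the message `send s` (where `s` is its current state) to all its
neighbours, and then updates its state by `receive` from its current state and the messages sent
by its neighbours. There is no bound on the size of states and messages, nor on the power of local
computations. (As messages are unbounded, one broadcast message per round can carry separate
messages addressed to the individual neighbours.) A vertex has made its choice as soon as `output`
is defined on its state; it may go on relaying messages afterwards, but the choice is final. -/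
structure LocalAlgorithm (I O : Type u) where
  State : Type u
  Message : Type u
  init : (n : ℕ) → (identifier : ℕ) → (input : I) → State
  send : State → Message
  receive : State → Multiset Message → State
  output : State → Option O

namespace LocalAlgorithm

/-- The state of the vertex `w` after `t` rounds of the algorithm `A` on the network `G`, with
identifiers `ident` and inputs `input`. -/
def stateAfter {I O : Type u} (A : LocalAlgorithm I O) {V : Type v} [Fintype V]
    (G : SimpleGraph V) [DecidableRel G.Adj] (ident : V → ℕ) (input : V → I) :
    (t : ℕ) → (w : V) → A.State
  | 0, w => A.init (Fintype.card V) (ident w) (input w)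
  | t + 1, w =>
      A.receive (stateAfter A G ident input t w)
        ((G.neighborFinset w).val.map fun x => A.send (stateAfter A G ident input t x))

/-- The vertex `w` chooses the output `o` after exactly `t` rounds, and not before. -/
def ChoosesAt {I O : Type u} (A : LocalAlgorithm I O) {V : Type v} [Fintype V]
    (G : SimpleGraph V) [DecidableRel G.Adj] (ident : V → ℕ) (input : V → I)
    (w : V) (t : ℕ) (o : O) : Prop :=
  A.output (A.stateAfter G ident input t w) = some o ∧
    ∀ s < t, A.output (A.stateAfter G ident input s w) = none

/-- On the given network the algorithm takes at most `r` rounds until every vertex has chosen its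
output, and the chosen outputs are `out`. -/
def ComputesWithin {I O : Type u} (A : LocalAlgorithm I O) {V : Type v} [Fintype V]
    (G : SimpleGraph V) [DecidableRel G.Adj] (ident : V → ℕ) (input : V → I)
    (out : V → O) (r : ℝ) : Prop :=
  ∀ w : V, ∃ t : ℕ, (t : ℝ) ≤ r ∧ A.ChoosesAt G ident input w t (out w)

end LocalAlgorithm

/-- Unique identifiers between `1` and the number of vertices. -/
def IsIdentifierAssignment {V : Type v} [Fintype V] (ident : V → ℕ) : Prop :=
  Function.Injective ident ∧ ∀ w : V, 1 ≤ ident w ∧ ident w ≤ Fintype.card V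

/-- What a vertex may output: a color, or the set of identifiers of the vertices of a clique. -/
inductive ColorOrClique (C : Type u) : Type u
  | color (c : C) : ColorOrClique C
  | clique (S : Finset ℕ) : ColorOrClique C

/-- The outputs exhibit a clique of `G` on `k` vertices: some vertex reports a clique, and every
vertex that reports one reports the identifiers of the vertices of an actual `k`-clique of `G`,
to which it belongs. -/
def FindsClique {C : Type u} {V : Type v} (G : SimpleGraph V) (ident : V → ℕ) (k : ℕ)
    (out : V → ColorOrClique C) : Prop :=
  (∃ (w : V) (S : Finset ℕ), out w = .clique S) ∧
    ∀ (w : V) (S : Finset ℕ), out w = .clique S →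
      ∃ Q : Finset V, G.IsNClique k Q ∧ w ∈ Q ∧ Q.image ident = S

/-- Every vertex outputs a color, and these form an `L`-list-coloring of `G`: a coloring of `G` in
which each vertex has a color of its own list. -/
def FindsListColoring {C : Type u} {V : Type v} (G : SimpleGraph V) (L : V → Finset C)
    (out : V → ColorOrClique C) : Prop :=
  ∃ c : G.Coloring C, ∀ w : V, c w ∈ L w ∧ out w = .color (c w)

/-! Vertices lying in a clique on `d + 1` vertices report one. It remains to color the set `U` of
the others, which induces no such clique and all of whose subsets have average degree at most `d`. A
vertex of `U` is rich if it has at most `d` neighbors in `U`, and poor otherwise. A rich vertex is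
happy if its ball of radius `R = O(log n)` among the rich vertices is flexible, i.e. can be colored
last, however the rest of `U` was colored; otherwise it is sad. One phase sets aside all happy
vertices and the rich vertices near some of them, colors what is left recursively, and then puts
them back. For this, a ruling set of happy roots is computed. Outside of the `R`-balls of the roots,
the colors are chosen greedily, farthest layer first, so that every vertex still has an uncolored
neighbor closer to a root. Finally, the balls are completed by flexibility (`extend_spec`).

The main point is that a fraction of order `1 / d ^ 2` of `U` is happy, and of order `1 / d` if all
degrees are at most `d` (`card_le_happy`, `card_le_happy_of_degree_le`). A connected set in the ball
of a sad vertex cannot be colored from some lists as large as its degrees. By Gallai's argument such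
a set splits at cut vertices into regular pieces with constant lists, and Brooks' theorem excludes
the degree `d` for a piece. A weighting then shows that at least a quarter of the set has degree
less than `d` inside the set (`IsBad.card_le`). Applied to balls that grow slowly, which exist
because `R` is a large multiple of `log n`, this shows that a constant fraction of the sad vertices
have a neighbor that is happy or poor (`card_le_of_not_happy`). Counting these edges against the
average degree bounds the sad and the poor vertices by the happy ones. So `O(d ^ 2 log n)` phases
suffice, or `O(d log n)` for degrees at most `d`.

A phase needs information from distance `O(d log² n)`. The output is defined as a function of the
whole network, its locality is tracked by `Zone`, and `gather` collects views until the value of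
this function is forced. Therefore one algorithm obeys both round bounds: once `U` is exhausted, the
phases that remain in the definition have no effect (`Zone.coloring_eq`). -/

namespace LocalColoring

set_option linter.unusedSectionVars false

open scoped Classical in
/-- The number of neighbors of `v` in `W`. -/
noncomputable def degreeIn {V : Type*} (G : SimpleGraph V) (W : Finset V) (v : V) : ℕ :=
  (W.filter (G.Adj v)).card

/-- `B` has a proper coloring in `G` with colors from the lists `L`. -/
def ListColorableOn {V C : Type*} (G : SimpleGraph V) (B : Finset V) (L : V → Finset C) : Prop :=
  ∃ c : V → C, (∀ u ∈ B, c u ∈ L u) ∧ ∀ u ∈ B, ∀ w ∈ B, G.Adj u w → c u ≠ c w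

/-- `B` is nonempty and induces a connected subgraph, in terms of edge cuts. -/
def ConnectedOn {V : Type*} (G : SimpleGraph V) (B : Finset V) : Prop :=
  B.Nonempty ∧ ∀ W ⊆ B, W.Nonempty → W ≠ B → ∃ u ∈ W, ∃ w ∈ B, w ∉ W ∧ G.Adj u w

/-! ### Greedy list coloring and connected sets -/

section Coloring

variable {V : Type*} [DecidableEq V] {C : Type*} {G : SimpleGraph V}

theorem degreeIn_mono {W W' : Finset V} (h : W ⊆ W') (v : V) :
    degreeIn G W v ≤ degreeIn G W' v := by
  classical
  exact Finset.card_le_card (Finset.filter_subset_filter _ h)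

theorem degreeIn_add_of_disjoint {W W' : Finset V} (h : Disjoint W W') (v : V) :
    degreeIn G (W ∪ W') v = degreeIn G W v + degreeIn G W' v := by
  classical
  unfold degreeIn
  rw [Finset.filter_union, Finset.card_union_of_disjoint]
  exact Finset.disjoint_filter_filter h

theorem degreeIn_add_sdiff {W B : Finset V} (h : W ⊆ B) (v : V) :
    degreeIn G W v + degreeIn G (B \ W) v = degreeIn G B v := by
  rw [← degreeIn_add_of_disjoint Finset.disjoint_sdiff, Finset.union_sdiff_of_subset h]

theorem degreeIn_pos {W : Finset V} {v w : V} (hw : w ∈ W) (h : G.Adj v w) :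
    0 < degreeIn G W v := by
  classical
  exact Finset.card_pos.2 ⟨w, Finset.mem_filter.2 ⟨hw, h⟩⟩

theorem degreeIn_erase {W : Finset V} {v x : V} (hx : x ∈ W) (h : G.Adj v x) :
    degreeIn G (W.erase x) v + 1 = degreeIn G W v := by
  classical
  unfold degreeIn
  rw [Finset.filter_erase]
  exact Finset.card_erase_add_one (Finset.mem_filter.2 ⟨hx, h⟩)

theorem degreeIn_erase_of_not_adj {W : Finset V} {v x : V} (h : ¬ G.Adj v x) :
    degreeIn G (W.erase x) v = degreeIn G W v := by
  classical
  unfold degreeIn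
  rw [Finset.filter_erase, Finset.erase_eq_of_notMem]
  simp [h]

theorem degreeIn_congr {W W' : Finset V} {v : V} (h : ∀ w, G.Adj v w → (w ∈ W ↔ w ∈ W')) :
    degreeIn G W v = degreeIn G W' v := by
  classical
  unfold degreeIn
  congr 1
  ext w
  simp only [Finset.mem_filter]
  constructor <;> rintro ⟨a, b⟩
  · exact ⟨(h w b).1 a, b⟩
  · exact ⟨(h w b).2 a, b⟩

theorem degreeIn_lt_card {W : Finset V} {v : V} (hv : v ∈ W) : degreeIn G W v < W.card := by
  classical
  refine Finset.card_lt_card ⟨Finset.filter_subset _ _, fun h => ?_⟩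
  exact G.loopless.irrefl v (Finset.mem_filter.1 (h hv)).2

/-- Greedy extension of a coloring `c₀` of `X` to `X ∪ D`: the vertices of `D` are colored by
decreasing rank, so that a vertex is safe if it has a spare color or a neighbor in `D` of smaller
rank. -/
theorem exists_extension (ρ : V → ℕ) (D : Finset V) (L : V → Finset C) (X : Finset V) (c₀ : V → C)
    [DecidableEq C] [DecidableRel G.Adj] (hdisj : Disjoint X D) (hL : ∀ u ∈ X, c₀ u ∈ L u)
    (hproper : ∀ u ∈ X, ∀ w ∈ X, G.Adj u w → c₀ u ≠ c₀ w)
    (h : ∀ u ∈ D, ((X.filter (G.Adj u)).image c₀).card + degreeIn G D u < (L u).card ∨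
      (((X.filter (G.Adj u)).image c₀).card + degreeIn G D u ≤ (L u).card ∧
        ∃ w ∈ D, G.Adj u w ∧ ρ w < ρ u)) :
    ∃ c : V → C, (∀ u ∈ X, c u = c₀ u) ∧ (∀ u ∈ X ∪ D, c u ∈ L u) ∧
      ∀ u ∈ X ∪ D, ∀ w ∈ X ∪ D, G.Adj u w → c u ≠ c w := by
  induction hn : D.card generalizing D X c₀ with
  | zero =>
    rw [Finset.card_eq_zero] at hn
    subst hn
    exact ⟨c₀, fun _ _ => rfl, by simpa using hL, by simpa using hproper⟩
  | succ n ih =>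
    have hne : D.Nonempty := Finset.card_pos.1 (by omega)
    obtain ⟨v, hvD, hv⟩ := Finset.exists_max_image D ρ hne
    have hvX : v ∉ X := fun hx => Finset.disjoint_left.1 hdisj hx hvD
    have hlt : ((X.filter (G.Adj v)).image c₀).card < (L v).card := by
      rcases h v hvD with h1 | ⟨h1, w, hw, hvw, -⟩
      · omega
      · have := degreeIn_pos hw hvw
        omega
    obtain ⟨a, haL, ha⟩ := Finset.exists_mem_notMem_of_card_lt_card hlt
    have hc : ∀ u ∈ X, Function.update c₀ v a u = c₀ u := fun u hu =>
      Function.update_of_ne (ne_of_mem_of_not_mem hu hvX) _ _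
    have hav : ∀ w ∈ X, G.Adj v w → a ≠ c₀ w := fun w hw hvw e =>
      ha (Finset.mem_image.2 ⟨w, Finset.mem_filter.2 ⟨hw, hvw⟩, e.symm⟩)
    obtain ⟨c, hcX, hcL, hcp⟩ := ih (D.erase v) (insert v X) (Function.update c₀ v a)
      (by
        rw [Finset.disjoint_insert_left]
        exact ⟨Finset.notMem_erase _ _, hdisj.mono_right (Finset.erase_subset _ _)⟩)
      (by
        intro u hu
        rcases Finset.mem_insert.1 hu with rfl | hu
        · simpa using haL
        · rw [hc u hu]; exact hL u hu)
      (by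
        intro u hu w hw huw
        rcases Finset.mem_insert.1 hu with hu' | hu'
        · subst hu'
          rcases Finset.mem_insert.1 hw with hw' | hw'
          · subst hw'; exact (G.loopless.irrefl _ huw).elim
          · rw [hc w hw', Function.update_self]
            exact hav w hw' huw
        · rcases Finset.mem_insert.1 hw with hw' | hw'
          · subst hw'
            rw [hc u hu', Function.update_self]
            exact (hav u hu' huw.symm).symm
          · rw [hc u hu', hc w hw']
            exact hproper u hu' w hw' huw)
      (by
        intro u hu
        have huD := Finset.mem_of_mem_erase hu
        have himg : (((insert v X).filter (G.Adj u)).image (Function.update c₀ v a)).card +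
            degreeIn G (D.erase v) u ≤
            ((X.filter (G.Adj u)).image c₀).card + degreeIn G D u := by
          have he : (X.filter (G.Adj u)).image (Function.update c₀ v a) =
              (X.filter (G.Adj u)).image c₀ :=
            Finset.image_congr fun w hw => hc w (Finset.mem_filter.1 hw).1
          by_cases huv : G.Adj u v
          · rw [Finset.filter_insert, if_pos huv, Finset.image_insert, he]
            have := degreeIn_erase hvD huv
            have := Finset.card_insert_le (Function.update c₀ v a v)
              ((X.filter (G.Adj u)).image c₀)
            omega
          · rw [Finset.filter_insert, if_neg huv, he, degreeIn_erase_of_not_adj huv]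
        rcases h u huD with h1 | ⟨h1, w, hw, huw, hlt⟩
        · left; omega
        · right
          refine ⟨by omega, w, Finset.mem_erase.2 ⟨?_, hw⟩, huw, hlt⟩
          rintro rfl
          exact absurd (hv u huD) (by omega))
      (by rw [Finset.card_erase_of_mem hvD]; omega)
    have hunion : insert v X ∪ D.erase v = X ∪ D := by
      rw [Finset.insert_union, ← Finset.union_insert, Finset.insert_erase hvD]
    rw [hunion] at hcL hcp
    exact ⟨c, fun u hu => (hcX u (Finset.mem_insert_of_mem hu)).trans (hc u hu), hcL, hcp⟩

/-- Coloring from scratch by decreasing rank: a vertex without a spare color keeps a neighbor that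
is colored after it. -/
theorem listColorableOn_of_rank [Nonempty C] (ρ : V → ℕ) (B : Finset V) (L : V → Finset C)
    (h : ∀ u ∈ B, degreeIn G B u < (L u).card ∨
      (degreeIn G B u ≤ (L u).card ∧ ∃ w ∈ B, G.Adj u w ∧ ρ w < ρ u)) :
    ListColorableOn G B L := by
  classical
  obtain ⟨c, -, h1, h2⟩ := exists_extension ρ B L ∅ (fun _ => Classical.arbitrary C)
    (by simp) (by simp) (by simp) (by simpa using h)
  exact ⟨c, by simpa using h1, by simpa using h2⟩

/-- The rank plays the role of the distance from `X`. A largest set that contains `X` and carries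
such ranks must be `B`: otherwise connectivity gives an edge leaving it, whose outer end could be
ranked one higher than its inner end. -/
theorem ConnectedOn.exists_rank {B X : Finset V} (hB : ConnectedOn G B) (hX : X.Nonempty)
    (hXB : X ⊆ B) : ∃ ρ : V → ℕ, ∀ u ∈ B, u ∉ X → ∃ w ∈ B, G.Adj u w ∧ ρ w < ρ u := by
  classical
  let good : Finset V → Prop := fun W =>
    X ⊆ W ∧ ∃ ρ : V → ℕ, ∀ u ∈ W, u ∉ X → ∃ w ∈ W, G.Adj u w ∧ ρ w < ρ u
  have hne : (B.powerset.filter good).Nonempty :=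
    ⟨X, Finset.mem_filter.2 ⟨Finset.mem_powerset.2 hXB, subset_rfl, fun _ => 0,
      fun u hu hu' => (hu' hu).elim⟩⟩
  obtain ⟨W, hW, hmax⟩ := Finset.exists_max_image _ Finset.card hne
  obtain ⟨hWB, hXW, ρ, hρ⟩ := Finset.mem_filter.1 hW
  rw [Finset.mem_powerset] at hWB
  by_cases hWe : W = B
  · subst hWe; exact ⟨ρ, hρ⟩
  · obtain ⟨u, hu, w, hw, hwW, huw⟩ := hB.2 W hWB (hX.mono hXW) hWe
    have hmem : insert w W ∈ B.powerset.filter good := by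
      refine Finset.mem_filter.2 ⟨Finset.mem_powerset.2 (Finset.insert_subset hw hWB),
        hXW.trans (Finset.subset_insert _ _), Function.update ρ w (ρ u + 1), ?_⟩
      have hupd : ∀ x ∈ W, Function.update ρ w (ρ u + 1) x = ρ x := fun x hx =>
        Function.update_of_ne (ne_of_mem_of_not_mem hx hwW) _ _
      intro x hx hxX
      rcases Finset.mem_insert.1 hx with rfl | hx
      · refine ⟨u, Finset.mem_insert_of_mem hu, huw.symm, ?_⟩
        rw [hupd u hu, Function.update_self]; omega
      · obtain ⟨y, hy, hxy, hlt⟩ := hρ x hx hxX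
        refine ⟨y, Finset.mem_insert_of_mem hy, hxy, ?_⟩
        rw [hupd x hx, hupd y hy]; exact hlt
    have := hmax _ hmem
    rw [Finset.card_insert_of_notMem hwW] at this
    omega

/-- Lists at least as large as the degrees suffice on a connected set with one larger list. -/
theorem ConnectedOn.listColorableOn [Nonempty C] {B : Finset V} (hB : ConnectedOn G B)
    {L : V → Finset C} (hL : ∀ u ∈ B, degreeIn G B u ≤ (L u).card) {x : V} (hx : x ∈ B)
    (hlt : degreeIn G B x < (L x).card) : ListColorableOn G B L := by
  obtain ⟨ρ, hρ⟩ := hB.exists_rank (X := {x}) (by simp) (by simpa using hx)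
  refine listColorableOn_of_rank ρ B L fun u hu => ?_
  by_cases h : u = x
  · subst h; exact Or.inl hlt
  · exact Or.inr ⟨hL u hu, hρ u hu (by simpa using h)⟩

/-- Gluing a connected set at a vertex `x` all of whose other connections leave. -/
theorem ConnectedOn.insert_of_closed {B W : Finset V} {x : V} (hB : ConnectedOn G B) (hx : x ∈ B)
    (hWB : W ⊆ B) (hxW : x ∉ W)
    (hcl : ∀ u ∈ W, ∀ w ∈ B, w ∉ W → G.Adj u w → w = x) : ConnectedOn G (insert x W) := by
  have key : ∀ Z ⊆ W, Z.Nonempty → ∃ u ∈ Z, ∃ w ∈ insert x W, w ∉ Z ∧ G.Adj u w := by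
    intro Z hZ hZne
    obtain ⟨u, hu, w, hw, hwZ, huw⟩ := hB.2 Z (hZ.trans hWB) hZne
      (fun e => hxW (hZ (e ▸ hx)))
    refine ⟨u, hu, w, ?_, hwZ, huw⟩
    by_cases hwW : w ∈ W
    · exact Finset.mem_insert_of_mem hwW
    · rw [hcl u (hZ hu) w hw hwW huw]; exact Finset.mem_insert_self _ _
  refine ⟨⟨x, Finset.mem_insert_self _ _⟩, fun Z hZ hZne hZe => ?_⟩
  by_cases hxZ : x ∈ Z
  · obtain ⟨u, hu, w, hw, hwZ, huw⟩ := key (insert x W \ Z)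
      (by
        intro y hy
        rw [Finset.mem_sdiff, Finset.mem_insert] at hy
        rcases hy with ⟨rfl | h, h'⟩
        · exact (h' hxZ).elim
        · exact h)
      (Finset.sdiff_nonempty.2 fun h => hZe (hZ.antisymm h))
    rw [Finset.mem_sdiff] at hu
    refine ⟨w, ?_, u, hu.1, hu.2, huw.symm⟩
    by_contra h
    exact hwZ (Finset.mem_sdiff.2 ⟨hw, h⟩)
  · refine key Z (fun y hy => ?_) hZne
    rcases Finset.mem_insert.1 (hZ hy) with rfl | h
    · exact (hxZ hy).elim
    · exact h

end Coloring

/-! ### Brooks' theorem -/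

section Brooks

variable {V : Type*} [DecidableEq V] {C : Type*} {G : SimpleGraph V}

theorem card_image_add_degreeIn_le [DecidableEq C] [DecidableRel G.Adj] {B X D : Finset V}
    (hdisj : Disjoint X D) (hB : X ∪ D = B) (c : V → C) (u : V) :
    ((X.filter (G.Adj u)).image c).card + degreeIn G D u ≤ degreeIn G B u := by
  rw [← hB, degreeIn_add_of_disjoint hdisj]
  refine Nat.add_le_add_right (Finset.card_image_le.trans (le_of_eq ?_)) _
  unfold degreeIn
  congr

/-- Two neighbors with the same color block only one color. This is the spare color for the last
vertex in both cases of the proof of Brooks' theorem. -/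
theorem card_image_add_degreeIn_lt [DecidableEq C] [DecidableRel G.Adj] {B X D : Finset V}
    (hdisj : Disjoint X D) (hB : X ∪ D = B) (c : V → C) (u : V) {y z : V} (hy : y ∈ X)
    (hz : z ∈ X) (huy : G.Adj u y) (huz : G.Adj u z) (hyz : y ≠ z) (hc : c y = c z) :
    ((X.filter (G.Adj u)).image c).card + degreeIn G D u < degreeIn G B u := by
  rw [← hB, degreeIn_add_of_disjoint hdisj]
  refine Nat.add_lt_add_right (lt_of_lt_of_eq (lt_of_le_of_ne Finset.card_image_le ?_)
    (b := (X.filter (G.Adj u)).card) ?_) _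
  · intro h
    rw [Finset.card_image_iff] at h
    exact hyz (h (by simp [hy, huy]) (by simp [hz, huz]) hc)
  · unfold degreeIn
    congr

/-- Brooks' theorem for a connected regular set of vertices. The proof follows a longest path
starting with two nonadjacent vertices at distance two, as in Zając's short proof. -/
theorem listColorableOn_of_regular {d : ℕ} (hd : 3 ≤ d) {B : Finset V} (hB : ConnectedOn G B)
    (hreg : ∀ u ∈ B, degreeIn G B u = d) (hK : ∀ Q ⊆ B, ¬ G.IsNClique (d + 1) Q)
    (L₀ : Finset C) (hL₀ : L₀.card = d) : ListColorableOn G B (fun _ => L₀) := by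
  classical
  obtain ⟨κ₀, hκ₀⟩ : L₀.Nonempty := Finset.card_pos.1 (by omega)
  -- two nonadjacent neighbors of some vertex
  obtain ⟨v, hv⟩ := hB.1
  obtain ⟨x, hx, y, hy, hvx, hvy, hxy, hxyG⟩ : ∃ x ∈ B, ∃ y ∈ B, G.Adj v x ∧ G.Adj v y ∧ x ≠ y ∧
      ¬ G.Adj x y := by
    by_contra! hcon
    refine hK (insert v (B.filter (G.Adj v))) (Finset.insert_subset hv (Finset.filter_subset _ _))
      ⟨?_, ?_⟩
    · rw [SimpleGraph.isClique_iff]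
      intro a ha b hb hab
      simp only [Finset.coe_insert, Finset.coe_filter, Set.mem_insert_iff, Set.mem_ofPred_eq]
        at ha hb
      rcases ha with rfl | ⟨ha, ha'⟩
      · rcases hb with rfl | ⟨hb, hb'⟩
        · exact (hab rfl).elim
        · exact hb'
      · rcases hb with rfl | ⟨hb, hb'⟩
        · exact ha'.symm
        · exact hcon a ha b hb ha' hb' hab
    · rw [Finset.card_insert_of_notMem (by simp)]
      congr 1
      rw [← hreg v hv]
      unfold degreeIn
      congr
  -- a longest path
  let IsPath : ℕ → (ℕ → V) → Prop := fun r p =>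
    2 ≤ r ∧ (∀ i ≤ r, p i ∈ B) ∧ (∀ i ≤ r, ∀ k ≤ r, p i = p k → i = k) ∧
      (∀ i < r, G.Adj (p i) (p (i + 1))) ∧ ¬ G.Adj (p 0) (p 2)
  have hbound : ∀ r p, IsPath r p → r ≤ B.card := by
    rintro r p ⟨-, h1, h2, -⟩
    have := Finset.card_le_card_of_injOn (s := Finset.range r) (t := B) p
      (fun i hi => h1 i (Finset.mem_range.1 hi).le)
      (fun i hi k hk e => h2 i (Finset.mem_range.1 hi).le k (Finset.mem_range.1 hk).le e)
    simpa using this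
  have hstart : ∃ p, IsPath 2 p := by
    refine ⟨fun i => if i = 0 then x else if i = 1 then v else y, le_rfl, ?_, ?_, ?_, ?_⟩
    · intro i _; dsimp only; split_ifs <;> assumption
    · have h1 := hvx.ne
      have h2 := hvy.ne
      intro i hi k hk
      interval_cases i <;> interval_cases k <;> simp_all [eq_comm]
    · intro i hi
      interval_cases i
      · simpa using hvx.symm
      · simpa using hvy
    · simpa using hxyG
  obtain ⟨r, ⟨p, hp⟩, hmax⟩ : ∃ r, (∃ p, IsPath r p) ∧ ∀ r' p', IsPath r' p' → r' ≤ r :=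
    ⟨Nat.findGreatest (fun r => ∃ p, IsPath r p) B.card,
      Nat.findGreatest_spec (P := fun r => ∃ p, IsPath r p)
        (hbound 2 _ hstart.choose_spec) hstart,
      fun r' p' h => Nat.le_findGreatest (hbound r' p' h) ⟨p', h⟩⟩
  obtain ⟨hr2, hpB, hinj, hadj, hp02⟩ := hp
  -- A neighbor of the end that is not on the path would prolong it without changing its first three
  -- vertices.
  have hend : ∀ w ∈ B, G.Adj (p r) w → ∃ i < r, p i = w := by
    intro w hw hrw
    by_contra! hcon
    have hne : ∀ i ≤ r, p i ≠ w := by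
      intro i hi
      rcases hi.lt_or_eq with h | rfl
      · exact hcon i h
      · exact hrw.ne
    have := hmax (r + 1) (fun i => if i ≤ r then p i else w) ⟨by omega, ?_, ?_, ?_, ?_⟩
    · omega
    · intro i _; dsimp only; split_ifs with h
      · exact hpB i h
      · exact hw
    · intro i hi k hk
      dsimp only
      split_ifs with h1 h2 h2
      · exact hinj i h1 k h2
      · exact fun e => (hne i h1 e).elim
      · exact fun e => (hne k h2 e.symm).elim
      · omega
    · intro i hi
      dsimp only
      rw [if_pos (by omega)]
      split_ifs with h
      · exact hadj i (by omega)
      · have : i = r := by omega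
        subst this; exact hrw
    · simpa [hr2] using hp02
  have hidx : ∃ idx : V → ℕ, ∀ i ≤ r, idx (p i) = i :=
    ⟨Function.invFunOn p {i | i ≤ r}, fun i hi =>
      hinj _ (Function.invFunOn_mem (f := p) (s := {i | i ≤ r}) ⟨i, hi, rfl⟩) _ hi
        (Function.invFunOn_eq (f := p) (s := {i | i ≤ r}) ⟨i, hi, rfl⟩)⟩
  obtain ⟨idx, hidx⟩ := hidx
  -- the smallest index of a neighbor of the end
  have hex : ∃ j, j < r ∧ G.Adj (p r) (p j) := by
    refine ⟨r - 1, by omega, ?_⟩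
    have := hadj (r - 1) (by omega)
    rw [Nat.sub_add_cancel (by omega)] at this
    exact this.symm
  obtain ⟨j, ⟨hjr, hjadj⟩, hjmin⟩ : ∃ j, (j < r ∧ G.Adj (p r) (p j)) ∧
      ∀ i, i < r → G.Adj (p r) (p i) → j ≤ i :=
    ⟨Nat.find hex, Nat.find_spec hex, fun i h1 h2 => Nat.find_min' hex ⟨h1, h2⟩⟩
  let Z : Finset V := (Finset.Icc j r).image p
  have hZ : ∀ i, j ≤ i → i ≤ r → p i ∈ Z := fun i h1 h2 =>
    Finset.mem_image_of_mem p (Finset.mem_Icc.2 ⟨h1, h2⟩)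
  have hZ' : ∀ u ∈ Z, ∃ i, j ≤ i ∧ i ≤ r ∧ p i = u := by
    intro u hu
    obtain ⟨i, hi, rfl⟩ := Finset.mem_image.1 hu
    exact ⟨i, (Finset.mem_Icc.1 hi).1, (Finset.mem_Icc.1 hi).2, rfl⟩
  have hZB : Z ⊆ B := by
    intro u hu
    obtain ⟨i, -, hi, rfl⟩ := hZ' u hu
    exact hpB i hi
  have hrZ : ∀ y ∈ B, G.Adj (p r) y → y ∈ Z := by
    intro y hy hry
    obtain ⟨i, hi, rfl⟩ := hend y hy hry
    exact hZ i (hjmin i hi hry) hi.le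
  by_cases hout : ∃ i, (j ≤ i ∧ i ≤ r) ∧ ∃ y ∈ B, y ∉ Z ∧ G.Adj (p i) y
  · -- color the outside of the cycle first
    let P : ℕ → Prop := fun i => j ≤ i ∧ ∃ y ∈ B, y ∉ Z ∧ G.Adj (p i) y
    -- `a` is the last index on the cycle with a neighbor `y` outside, so `p (a + 1)` has no
    -- neighbor outside and may copy the color of `y`.
    obtain ⟨a, har, ⟨hja, y, hyB, hyZ, hay⟩, hamax⟩ : ∃ a, a ≤ r ∧ P a ∧ ∀ i ≤ r, P i → i ≤ a := by
      obtain ⟨i, ⟨h1, h2⟩, h3⟩ := hout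
      exact ⟨Nat.findGreatest P r, Nat.findGreatest_le r,
        Nat.findGreatest_spec (P := P) h2 ⟨h1, h3⟩, fun i hi hP => Nat.le_findGreatest hi hP⟩
    have har' : a < r := by
      rcases har.lt_or_eq with h | rfl
      · exact h
      · exact (hyZ (hrZ y hyB hay)).elim
    obtain ⟨ρ, hρ⟩ := hB.exists_rank ⟨p r, hZ r hjr.le le_rfl⟩ hZB
    obtain ⟨c₀, -, hc₀L, hc₀⟩ := exists_extension (G := G) ρ (B \ Z) (fun _ => L₀) ∅ (fun _ => κ₀)
      (by simp) (by simp) (by simp) (by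
        intro u hu
        obtain ⟨huB, huZ⟩ := Finset.mem_sdiff.1 hu
        have h1 := degreeIn_add_sdiff (G := G) hZB u
        rw [hreg u huB] at h1
        obtain ⟨w, hw, huw, hlt⟩ := hρ u huB huZ
        by_cases hwZ : w ∈ Z
        · left
          have := degreeIn_pos hwZ huw
          simp only [Finset.filter_empty, Finset.image_empty, Finset.card_empty]
          omega
        · right
          simp only [Finset.filter_empty, Finset.image_empty, Finset.card_empty]
          exact ⟨by omega, w, Finset.mem_sdiff.2 ⟨hw, hwZ⟩, huw, hlt⟩)
    rw [Finset.empty_union] at hc₀L hc₀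
    have hqZ : p (a + 1) ∈ Z := hZ _ (by omega) (by omega)
    have hq : ∀ w ∈ B \ Z, ¬ G.Adj (p (a + 1)) w := by
      intro w hw hadjw
      have := hamax (a + 1) (by omega) ⟨by omega, w, (Finset.mem_sdiff.1 hw).1,
        (Finset.mem_sdiff.1 hw).2, hadjw⟩
      omega
    have hupd : ∀ w ∈ B \ Z, Function.update c₀ (p (a + 1)) (c₀ y) w = c₀ w := fun w hw =>
      Function.update_of_ne (ne_of_mem_of_not_mem hqZ (Finset.mem_sdiff.1 hw).2).symm _ _
    have hyBZ : y ∈ B \ Z := Finset.mem_sdiff.2 ⟨hyB, hyZ⟩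
    have hdisj : Disjoint (insert (p (a + 1)) (B \ Z)) (Z.erase (p (a + 1))) := by
      rw [Finset.disjoint_left]
      intro w hw hw'
      rw [Finset.mem_erase] at hw'
      rw [Finset.mem_insert, Finset.mem_sdiff] at hw
      tauto
    have hunion : insert (p (a + 1)) (B \ Z) ∪ Z.erase (p (a + 1)) = B := by
      ext w
      simp only [Finset.mem_union, Finset.mem_insert, Finset.mem_sdiff, Finset.mem_erase]
      constructor
      · rintro ((rfl | h) | h)
        · exact hZB hqZ
        · exact h.1
        · exact hZB h.2
      · intro h; tauto
    -- The rank lets the coloring run around the cycle in the order `p (a + 2), …, p r, p j, …, p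
    -- a`. Each vertex before the last has its successor still uncolored, and `p a` sees one color
    -- twice, at `y` and at `p (a + 1)`.
    obtain ⟨c, -, hcL, hc⟩ := exists_extension (G := G)
      (fun u => if idx u ≤ a then a - idx u else (a - j) + 1 + (r - idx u))
      (Z.erase (p (a + 1))) (fun _ => L₀) (insert (p (a + 1)) (B \ Z))
      (Function.update c₀ (p (a + 1)) (c₀ y)) hdisj
      (by
        intro u hu
        rcases Finset.mem_insert.1 hu with hu' | hu'
        · rw [hu', Function.update_self]; exact hc₀L y hyBZ
        · rw [hupd u hu']; exact hc₀L u hu')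
      (by
        intro u hu w hw huw
        rcases Finset.mem_insert.1 hu with hu' | hu'
        · rcases Finset.mem_insert.1 hw with hw' | hw'
          · rw [hu', hw'] at huw; exact (G.loopless.irrefl _ huw).elim
          · rw [hu'] at huw; exact (hq w hw' huw).elim
        · rcases Finset.mem_insert.1 hw with hw' | hw'
          · rw [hw'] at huw; exact (hq u hu' huw.symm).elim
          · rw [hupd u hu', hupd w hw']; exact hc₀ u hu' w hw' huw)
      (by
        intro u hu
        obtain ⟨hne, huZ⟩ := Finset.mem_erase.1 hu
        obtain ⟨i, hji, hir, rfl⟩ := hZ' u huZ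
        have hia : i ≠ a + 1 := fun e => hne (by rw [e])
        by_cases hi : i = a
        · left
          subst hi
          rw [hL₀, ← hreg (p i) (hpB i hir)]
          exact card_image_add_degreeIn_lt hdisj hunion _ (p i) (y := y) (z := p (i + 1))
            (Finset.mem_insert_of_mem hyBZ) (Finset.mem_insert_self _ _) hay (hadj i har')
            (ne_of_mem_of_not_mem hqZ hyZ).symm (by rw [hupd y hyBZ, Function.update_self])
        · right
          rw [hL₀, ← hreg (p i) (hpB i hir)]
          refine ⟨card_image_add_degreeIn_le hdisj hunion _ (p i), ?_⟩
          rcases hir.lt_or_eq with hir' | rfl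
          · refine ⟨p (i + 1), Finset.mem_erase.2 ⟨fun e => ?_, hZ _ (by omega) (by omega)⟩,
              hadj i hir', ?_⟩
            · have := hinj _ (by omega) _ (by omega) e
              omega
            · rw [hidx i hir, hidx (i + 1) (by omega)]
              split_ifs <;> omega
          · refine ⟨p j, Finset.mem_erase.2 ⟨fun e => ?_, hZ _ le_rfl hjr.le⟩, hjadj, ?_⟩
            · have := hinj _ (by omega) _ (by omega) e
              omega
            · rw [hidx i hir, hidx j hjr.le]
              split_ifs <;> omega)
    rw [hunion] at hcL hc
    exact ⟨c, hcL, hc⟩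
  · -- the path is spanning
    push Not at hout
    have hZe : Z = B := by
      by_contra hne
      obtain ⟨u, hu, w, hw, hwZ, huw⟩ := hB.2 Z hZB ⟨p r, hZ r hjr.le le_rfl⟩ hne
      obtain ⟨i, h1, h2, rfl⟩ := hZ' u hu
      exact hout i ⟨h1, h2⟩ w hw hwZ huw
    have hB' : ∀ u ∈ B, ∃ i ≤ r, p i = u := by
      intro u hu
      rw [← hZe] at hu
      obtain ⟨i, -, h⟩ := hZ' u hu
      exact ⟨i, h⟩
    -- Since `d ≥ 3`, the vertex `p 1` has a neighbor besides `p 0` and `p 2`.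
    obtain ⟨m, hm3, hmr, h1m⟩ : ∃ m, 3 ≤ m ∧ m ≤ r ∧ G.Adj (p 1) (p m) := by
      by_contra! hcon
      have : degreeIn G B (p 1) ≤ 2 := by
        unfold degreeIn
        refine (Finset.card_le_card (t := {p 0, p 2}) fun w hw => ?_).trans Finset.card_le_two
        obtain ⟨hwB, h1w⟩ := Finset.mem_filter.1 hw
        obtain ⟨i, hi, rfl⟩ := hB' w hwB
        have h3 : i < 3 := by
          by_contra h
          exact hcon i (by omega) hi h1w
        interval_cases i
        · simp
        · exact (G.loopless.irrefl _ h1w).elim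
        · simp
      rw [hreg _ (hpB 1 (by omega))] at this
      omega
    have h0 := hpB 0 (by omega)
    have h2 := hpB 2 (by omega)
    have hsub : ({p 0, p 2} : Finset V) ⊆ B := by
      intro w hw
      simp only [Finset.mem_insert, Finset.mem_singleton] at hw
      rcases hw with rfl | rfl <;> assumption
    have hunion : ({p 0, p 2} : Finset V) ∪ (B \ {p 0, p 2}) = B :=
      Finset.union_sdiff_of_subset hsub
    have hmem : ∀ i ≤ r, i ≠ 0 → i ≠ 2 → p i ∈ B \ {p 0, p 2} := by
      intro i hi h0 h2
      simp only [Finset.mem_sdiff, Finset.mem_insert, Finset.mem_singleton, not_or]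
      exact ⟨hpB i hi, fun e => h0 (hinj i hi 0 (by omega) e),
        fun e => h2 (hinj i hi 2 (by omega) e)⟩
    -- `p 0` and `p 2` share the color `κ₀`. The others are colored along the path toward `p m` from
    -- both sides, then comes `p m`, which still has `p 1` uncolored, and `p 1` is last. With
    -- truncated subtraction the rank away from `p 1` is `1 + |idx u - m|`.
    obtain ⟨c, -, hcL, hc⟩ := exists_extension (G := G)
      (fun u => if idx u = 1 then 0 else 1 + (m - idx u) + (idx u - m))
      (B \ {p 0, p 2}) (fun _ => L₀) {p 0, p 2} (fun _ => κ₀) Finset.disjoint_sdiff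
      (fun _ _ => hκ₀)
      (by
        intro u hu w hw huw
        simp only [Finset.mem_insert, Finset.mem_singleton] at hu hw
        rcases hu with rfl | rfl <;> rcases hw with rfl | rfl
        · exact (G.loopless.irrefl _ huw).elim
        · exact (hp02 huw).elim
        · exact (hp02 huw.symm).elim
        · exact (G.loopless.irrefl _ huw).elim)
      (by
        intro u hu
        simp only [Finset.mem_sdiff, Finset.mem_insert, Finset.mem_singleton, not_or] at hu
        obtain ⟨huB, hu0, hu2⟩ := hu
        obtain ⟨i, hir, rfl⟩ := hB' u huB
        have hi0 : i ≠ 0 := fun e => hu0 (by rw [e])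
        have hi2 : i ≠ 2 := fun e => hu2 (by rw [e])
        rw [hL₀, ← hreg (p i) huB]
        by_cases hi1 : i = 1
        · left
          subst hi1
          exact card_image_add_degreeIn_lt Finset.disjoint_sdiff hunion _ (p 1) (y := p 0)
            (z := p 2) (by simp) (by simp) (hadj 0 (by omega)).symm (hadj 1 (by omega))
            (fun e => by have := hinj 0 (by omega) 2 (by omega) e; omega) rfl
        · right
          refine ⟨card_image_add_degreeIn_le Finset.disjoint_sdiff hunion _ (p i), ?_⟩
          rcases lt_trichotomy i m with him | rfl | him
          · refine ⟨p (i + 1), hmem _ (by omega) (by omega) (by omega), hadj i (by omega), ?_⟩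
            rw [hidx i hir, hidx (i + 1) (by omega)]
            split_ifs <;> omega
          · refine ⟨p 1, hmem _ (by omega) (by omega) (by omega), h1m.symm, ?_⟩
            rw [hidx i hir, hidx 1 (by omega)]
            split_ifs <;> omega
          · obtain ⟨k, rfl⟩ : ∃ k, i = k + 1 := ⟨i - 1, by omega⟩
            refine ⟨p k, hmem _ (by omega) (by omega) (by omega), (hadj k (by omega)).symm, ?_⟩
            rw [hidx (k + 1) hir, hidx k (by omega)]
            split_ifs <;> omega)
    rw [hunion] at hcL hc
    exact ⟨c, hcL, hc⟩

end Brooks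

/-! ### Uncolorable sets with lists as large as the degrees (Gallai trees) -/

/-- `B` is connected and has no coloring from the lists `L`, although no list is smaller than the
degree of its vertex in `B`. -/
structure IsBad {V C : Type*} (G : SimpleGraph V) (B : Finset V) (L : V → Finset C) : Prop where
  connected : ConnectedOn G B
  degreeIn_le : ∀ u ∈ B, degreeIn G B u ≤ (L u).card
  not_colorable : ¬ ListColorableOn G B L

section Bad

variable {V : Type*} [DecidableEq V] {C : Type*} [Nonempty C] {G : SimpleGraph V}

/-- A single list larger than the degree would let the whole connected set be colored toward that
vertex. -/
theorem IsBad.card_eq {B : Finset V} {L : V → Finset C} (h : IsBad G B L) {u : V} (hu : u ∈ B) :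
    (L u).card = degreeIn G B u := by
  by_contra hne
  exact h.not_colorable (h.connected.listColorableOn h.degreeIn_le hu
    (lt_of_le_of_ne (h.degreeIn_le u hu) (Ne.symm hne)))

theorem degreeIn_insert_self (W : Finset V) (x : V) :
    degreeIn G (insert x W) x = degreeIn G W x := by
  classical
  unfold degreeIn
  rw [Finset.filter_insert, if_neg (G.loopless.irrefl x)]

/-- A bad pair splits at a cut vertex into two bad pairs. -/
theorem IsBad.split {B W : Finset V} {L : V → Finset C} (h : IsBad G B L) {x : V} (hx : x ∈ B)
    (hWB : W ⊆ B) (hxW : x ∉ W) (hcl : ∀ u ∈ W, ∀ w ∈ B, w ∉ W → G.Adj u w → w = x) :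
    (∃ L' : V → Finset C, IsBad G (insert x W) L') ∧ ∃ L' : V → Finset C, IsBad G (B \ W) L' := by
  classical
  have hc1 : ConnectedOn G (insert x W) := h.connected.insert_of_closed hx hWB hxW hcl
  have hins : insert x ((B \ W).erase x) = B \ W :=
    Finset.insert_erase (Finset.mem_sdiff.2 ⟨hx, hxW⟩)
  have hc2 : ConnectedOn G (B \ W) := by
    rw [← hins]
    refine h.connected.insert_of_closed hx (fun u hu => ?_) (Finset.notMem_erase _ _) ?_
    · exact (Finset.mem_sdiff.1 (Finset.mem_of_mem_erase hu)).1
    · intro u hu w hw hwn huw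
      rw [Finset.mem_erase, Finset.mem_sdiff] at hu hwn
      by_contra hwx
      have hwW : w ∈ W := by by_contra hwW; exact hwn ⟨hwx, hw, hwW⟩
      exact hu.1 (hcl w hwW u hu.2.1 hu.2.2 huw.symm)
  have hB1 : insert x W ⊆ B := Finset.insert_subset hx hWB
  -- These are the colors at `x` that extend to no coloring of `B'`. Every color of `L x` is
  -- rejected by one of the two sides, for otherwise the colorings could be glued, and neither side
  -- rejects more colors than its degree at `x`. As the two degrees add up to at most `(L x).card`,
  -- both counts are tight, and cutting the list of `x` down to the rejected colors keeps each side
  -- bad.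
  let rej : Finset V → Finset C := fun B' => (L x).filter fun a =>
    ¬ ∃ c : V → C, c x = a ∧ (∀ u ∈ B', c u ∈ L u) ∧ ∀ u ∈ B', ∀ w ∈ B', G.Adj u w → c u ≠ c w
  let L' : Finset V → V → Finset C := fun B' => Function.update L x (rej B')
  have hnot : ∀ B', x ∈ B' → ¬ ListColorableOn G B' (L' B') := by
    rintro B' hxB' ⟨c, hcL, hc⟩
    have h1 := hcL x hxB'
    simp only [L', Function.update_self, rej, Finset.mem_filter] at h1
    refine h1.2 ⟨c, rfl, fun u hu => ?_, hc⟩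
    by_cases hux : u = x
    · subst hux; exact h1.1
    · have := hcL u hu
      simpa only [L', Function.update_of_ne hux] using this
  have hcard : ∀ B' ⊆ B, x ∈ B' → ConnectedOn G B' → degreeIn G B' x ≤ (rej B').card →
      IsBad G B' (L' B') := by
    intro B' hB' hxB' hcon hle
    refine ⟨hcon, fun u hu => ?_, hnot B' hxB'⟩
    by_cases hux : u = x
    · subst hux; simpa only [L', Function.update_self] using hle
    · simp only [L', Function.update_of_ne hux]
      exact (degreeIn_mono hB' u).trans (h.degreeIn_le u (hB' hu))
  have hle : ∀ B' ⊆ B, x ∈ B' → ConnectedOn G B' → (rej B').card ≤ degreeIn G B' x := by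
    intro B' hB' hxB' hcon
    by_contra! hlt
    have hbad := hcard B' hB' hxB' hcon hlt.le
    have := hbad.card_eq hxB'
    simp only [L', Function.update_self] at this
    omega
  have hx1 : x ∈ insert x W := Finset.mem_insert_self _ _
  have hx2 : x ∈ B \ W := Finset.mem_sdiff.2 ⟨hx, hxW⟩
  have hcover : L x ⊆ rej (insert x W) ∪ rej (B \ W) := by
    intro a ha
    by_contra hcon
    simp only [rej, Finset.mem_union, Finset.mem_filter, not_or, not_and, not_not] at hcon
    obtain ⟨c1, h1x, h1L, h1⟩ := hcon.1 ha
    obtain ⟨c2, h2x, h2L, h2⟩ := hcon.2 ha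
    refine h.not_colorable ⟨fun u => if u ∈ W then c1 u else c2 u, fun u hu => ?_, ?_⟩
    · dsimp only
      split_ifs with huW
      · exact h1L u (Finset.mem_insert_of_mem huW)
      · exact h2L u (Finset.mem_sdiff.2 ⟨hu, huW⟩)
    · intro u hu w hw huw
      dsimp only
      split_ifs with huW hwW hwW
      · exact h1 u (Finset.mem_insert_of_mem huW) w (Finset.mem_insert_of_mem hwW) huw
      · have e := hcl u huW w hw hwW huw
        subst e
        rw [h2x, ← h1x]
        exact h1 u (Finset.mem_insert_of_mem huW) w hx1 huw
      · have e := hcl w hwW u hu huW huw.symm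
        subst e
        rw [h2x, ← h1x]
        exact h1 u hx1 w (Finset.mem_insert_of_mem hwW) huw
      · exact h2 u (Finset.mem_sdiff.2 ⟨hu, huW⟩) w (Finset.mem_sdiff.2 ⟨hw, hwW⟩) huw
  have hsum := (Finset.card_le_card hcover).trans (Finset.card_union_le _ _)
  have hdeg := degreeIn_add_sdiff (G := G) hWB x
  have h1 := hle _ hB1 hx1 hc1
  have h2 := hle _ Finset.sdiff_subset hx2 hc2
  rw [degreeIn_insert_self] at h1
  have h3 := h.degreeIn_le x hx
  exact ⟨⟨_, hcard _ hB1 hx1 hc1 (by rw [degreeIn_insert_self]; omega)⟩,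
    ⟨_, hcard _ Finset.sdiff_subset hx2 hc2 (by omega)⟩⟩

/-- If `a` is in `L x` but not in `L u`, then giving `a` to `x` costs `u` a neighbor and no color.
So `u` gains a spare color, and the connected rest can be colored toward `u`. -/
theorem IsBad.subset_of_adj {B : Finset V} {L : V → Finset C} (h : IsBad G B L) {x u : V}
    (hx : x ∈ B) (hu : u ∈ B) (hxu : G.Adj x u) (hcon : ConnectedOn G (B.erase x)) :
    L x ⊆ L u := by
  classical
  intro a ha
  by_contra hau
  have huB : u ∈ B.erase x := Finset.mem_erase.2 ⟨hxu.ne.symm, hu⟩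
  obtain ⟨c, hcL, hc⟩ := hcon.listColorableOn
    (L := fun w => if G.Adj x w then (L w).erase a else L w) (x := u)
    (by
      intro w hw
      have h1 := h.degreeIn_le w (Finset.mem_of_mem_erase hw)
      split_ifs with hxw
      · have := degreeIn_erase hx hxw.symm
        have := Finset.pred_card_le_card_erase (s := L w) (a := a)
        omega
      · rwa [degreeIn_erase_of_not_adj (fun h => hxw h.symm)])
    huB
    (by
      have h1 := h.degreeIn_le u hu
      have := degreeIn_erase hx hxu.symm
      rw [if_pos hxu, Finset.erase_eq_of_notMem hau]
      omega)
  have hupd : ∀ w ∈ B, w ≠ x → Function.update c x a w = c w := fun w _ hw =>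
    Function.update_of_ne hw _ _
  have key : ∀ w ∈ B, w ≠ x → c w ∈ L w ∧ (G.Adj x w → c w ≠ a) := by
    intro w hw hwx
    have := hcL w (Finset.mem_erase.2 ⟨hwx, hw⟩)
    dsimp only at this
    split_ifs at this with hxw
    · rw [Finset.mem_erase] at this
      exact ⟨this.2, fun _ => this.1⟩
    · exact ⟨this, fun h => (hxw h).elim⟩
  refine h.not_colorable ⟨Function.update c x a, fun w hw => ?_, fun w hw z hz hwz => ?_⟩
  · by_cases hwx : w = x
    · subst hwx; simpa using ha
    · rw [hupd w hw hwx]; exact (key w hw hwx).1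
  · by_cases hwx : w = x
    · subst hwx
      rw [Function.update_self, hupd z hz hwz.ne.symm]
      exact ((key z hz hwz.ne.symm).2 hwz).symm
    · rw [hupd w hw hwx]
      by_cases hzx : z = x
      · subst hzx
        rw [Function.update_self]
        exact (key w hw hwx).2 hwz.symm
      · rw [hupd z hz hzx]
        exact hc w (Finset.mem_erase.2 ⟨hwx, hw⟩) z (Finset.mem_erase.2 ⟨hzx, hz⟩) hwz

/-- Without cut vertices, all lists of a bad pair coincide. -/
theorem IsBad.lists_eq {B : Finset V} {L : V → Finset C} (h : IsBad G B L)
    (hcon : ∀ x ∈ B, B.erase x = ∅ ∨ ConnectedOn G (B.erase x)) {x y : V} (hx : x ∈ B)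
    (hy : y ∈ B) : L x = L y := by
  classical
  have hadj : ∀ u ∈ B, ∀ w ∈ B, G.Adj u w → L u ⊆ L w := by
    intro u hu w hw huw
    rcases hcon u hu with h1 | h1
    · have : w ∈ B.erase u := Finset.mem_erase.2 ⟨huw.ne.symm, hw⟩
      rw [h1] at this
      simp at this
    · exact h.subset_of_adj hu hw huw h1
  by_contra hne
  obtain ⟨u, hu, w, hw, hwn, huw⟩ := h.connected.2 (B.filter fun u => L u = L x)
    (Finset.filter_subset _ _) ⟨x, by simp [hx]⟩ (fun e => by
      rw [← e, Finset.mem_filter] at hy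
      exact hne hy.2.symm)
  rw [Finset.mem_filter] at hu hwn
  exact hwn ⟨hw, ((hadj w hw u hu.1 huw.symm).antisymm (hadj u hu.1 w hw huw)).trans hu.2⟩

/-- The weight of a vertex of degree `k` in the counting of the vertices of full degree `d`. -/
def weight (d k : ℕ) : ℤ := if k = d then 1 else if k = 0 then -6 else if k = 1 then -3 else -2

/-- The price of gluing two pieces at a cut vertex. The assumption `d ≥ 3` matters for `a = b = 1`:
the right side is `0`, so `2` must not be the full degree. -/
theorem weight_add_le {d a b : ℕ} (hd : 3 ≤ d) (ha : 1 ≤ a) (hb : 1 ≤ b) (hab : a + b ≤ d) :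
    weight d (a + b) ≤ weight d a + weight d b + 6 := by
  unfold weight
  split_ifs <;> omega

/-- Without cut vertices all lists coincide, so `B` is regular of some degree `k`; Brooks' theorem
excludes `k = d`, and there are at least `k + 1` vertices. The weights are chosen such that one
vertex for `k = 0`, two for `k = 1` and three for larger `k` already reach `-6`. At a cut vertex,
the bounds `-6` of both sides add up to `-12`, and gluing gives back at most `6`. -/
theorem IsBad.sum_weight_le {d : ℕ} (hd : 3 ≤ d) {B : Finset V} {L : V → Finset C}
    (h : IsBad G B L) (hdeg : ∀ u ∈ B, degreeIn G B u ≤ d)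
    (hK : ∀ Q ⊆ B, ¬ G.IsNClique (d + 1) Q) :
    ∑ u ∈ B, weight d (degreeIn G B u) + 6 ≤ 0 := by
  induction hn : B.card using Nat.strong_induction_on generalizing B L with
  | _ n ih =>
  by_cases hcut : ∀ x ∈ B, B.erase x = ∅ ∨ ConnectedOn G (B.erase x)
  · obtain ⟨x, hx⟩ := h.connected.1
    have hreg : ∀ u ∈ B, degreeIn G B u = degreeIn G B x := fun u hu => by
      rw [← h.card_eq hu, ← h.card_eq hx, h.lists_eq hcut hu hx]
    have hkd : degreeIn G B x ≠ d := by
      intro e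
      obtain ⟨c, h1, h2⟩ := listColorableOn_of_regular hd h.connected
        (fun u hu => (hreg u hu).trans e) hK (L x) ((h.card_eq hx).trans e)
      exact h.not_colorable ⟨c, fun u hu => h.lists_eq hcut hu hx ▸ h1 u hu, h2⟩
    rw [Finset.sum_congr rfl fun u hu => by rw [hreg u hu], Finset.sum_const, nsmul_eq_mul]
    have hlt := degreeIn_lt_card (G := G) hx
    unfold weight
    rw [if_neg hkd]
    split_ifs <;> omega
  · push Not at hcut
    obtain ⟨x, hx, hne, hnc⟩ := hcut
    have : ∃ W ⊆ B.erase x, W.Nonempty ∧ W ≠ B.erase x ∧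
        ∀ u ∈ W, ∀ w ∈ B.erase x, w ∉ W → ¬ G.Adj u w := by
      by_contra! hcon
      exact hnc ⟨hne, fun W h1 h2 h3 => hcon W h1 h2 h3⟩
    obtain ⟨W, hWe, hW, hWne, hWcl⟩ := this
    have hxW : x ∉ W := fun hxW => Finset.notMem_erase x B (hWe hxW)
    have hWB : W ⊆ B := hWe.trans (Finset.erase_subset _ _)
    have hcl : ∀ u ∈ W, ∀ w ∈ B, w ∉ W → G.Adj u w → w = x := by
      intro u hu w hw hwW huw
      by_contra hwx
      exact hWcl u hu w (Finset.mem_erase.2 ⟨hwx, hw⟩) hwW huw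
    obtain ⟨⟨L1, h1⟩, L2, h2⟩ := h.split hx hWB hxW hcl
    obtain ⟨y, hy, hyW⟩ : ∃ y ∈ B.erase x, y ∉ W := by
      by_contra! hcon
      exact hWne (hWe.antisymm hcon)
    obtain ⟨hyx, hyB⟩ := Finset.mem_erase.1 hy
    obtain ⟨z, hz⟩ := hW
    have hB1 : insert x W ⊆ B := Finset.insert_subset hx hWB
    have hx2 : x ∈ B \ W := Finset.mem_sdiff.2 ⟨hx, hxW⟩
    have hpos : ∀ {B' : Finset V} {L' : V → Finset C}, IsBad G B' L' → x ∈ B' →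
        (∃ z ∈ B', z ≠ x) → 1 ≤ degreeIn G B' x := by
      rintro B' L' hb hxB ⟨z, hz, hzx⟩
      obtain ⟨u, hu, w, hw, -, huw⟩ := hb.connected.2 {x} (by simpa using hxB) (by simp)
        (fun e => hzx (by rw [← e] at hz; simpa using hz))
      rw [Finset.mem_singleton] at hu
      subst hu
      exact degreeIn_pos hw huw
    have ha := hpos h1 (Finset.mem_insert_self _ _)
      ⟨z, Finset.mem_insert_of_mem hz, fun e => hxW (e ▸ hz)⟩
    have hb := hpos h2 hx2 ⟨y, Finset.mem_sdiff.2 ⟨hyB, hyW⟩, hyx⟩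
    have i1 := ih _ (by
      rw [← hn]
      exact Finset.card_lt_card ⟨hB1, fun hs => by
        have := hs hyB
        simp [hyx, hyW] at this⟩) h1
      (fun u hu => (degreeIn_mono hB1 u).trans (hdeg u (hB1 hu))) (fun Q hQ => hK Q (hQ.trans hB1))
      rfl
    have i2 := ih _ (by
      rw [← hn]
      exact Finset.card_lt_card ⟨Finset.sdiff_subset, fun hs => by
        have := hs (hWB hz)
        simp [hz] at this⟩) h2
      (fun u hu => (degreeIn_mono Finset.sdiff_subset u).trans
        (hdeg u (Finset.sdiff_subset hu))) (fun Q hQ => hK Q (hQ.trans Finset.sdiff_subset)) rfl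
    have hins : insert x ((B \ W).erase x) = B \ W := Finset.insert_erase hx2
    have s1 : ∑ u ∈ insert x W, weight d (degreeIn G (insert x W) u) =
        weight d (degreeIn G (insert x W) x) + ∑ u ∈ W, weight d (degreeIn G B u) := by
      rw [Finset.sum_insert hxW]
      congr 1
      refine Finset.sum_congr rfl fun u hu => ?_
      rw [degreeIn_congr fun w huw => ⟨fun hw => hB1 hw, fun hw => ?_⟩]
      by_cases hwW : w ∈ W
      · exact Finset.mem_insert_of_mem hwW
      · rw [hcl u hu w hw hwW huw]; exact Finset.mem_insert_self _ _
    have s2 : ∑ u ∈ B \ W, weight d (degreeIn G (B \ W) u) =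
        weight d (degreeIn G (B \ W) x) +
          ∑ u ∈ (B \ W).erase x, weight d (degreeIn G B u) := by
      rw [← Finset.add_sum_erase _ _ hx2]
      congr 1
      refine Finset.sum_congr rfl fun u hu => ?_
      rw [degreeIn_congr fun w huw => ⟨fun hw => Finset.sdiff_subset hw, fun hw => ?_⟩]
      rw [Finset.mem_erase, Finset.mem_sdiff] at hu
      refine Finset.mem_sdiff.2 ⟨hw, fun hwW => hu.1 (hcl w hwW u hu.2.1 hu.2.2 huw.symm)⟩
    have s3 : ∑ u ∈ B, weight d (degreeIn G B u) = ∑ u ∈ W, weight d (degreeIn G B u) +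
        (weight d (degreeIn G B x) + ∑ u ∈ (B \ W).erase x, weight d (degreeIn G B u)) := by
      rw [Finset.add_sum_erase (B \ W) (fun u => weight d (degreeIn G B u)) hx2, add_comm,
        Finset.sum_sdiff hWB]
    have hsum : degreeIn G B x = degreeIn G (insert x W) x + degreeIn G (B \ W) x := by
      rw [degreeIn_insert_self, degreeIn_add_sdiff hWB]
    have hw := weight_add_le hd ha hb (hsum ▸ hdeg x hx)
    rw [← hsum] at hw
    omega

/-- In a connected set of maximum degree at most `d` that is not colorable from some lists as large
as the degrees, at most three quarters of the vertices have degree `d`. -/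
theorem IsBad.card_le {d : ℕ} (hd : 3 ≤ d) {B : Finset V} {L : V → Finset C}
    (h : IsBad G B L) (hdeg : ∀ u ∈ B, degreeIn G B u ≤ d)
    (hK : ∀ Q ⊆ B, ¬ G.IsNClique (d + 1) Q) :
    B.card ≤ 4 * (B.filter fun u => degreeIn G B u < d).card := by
  have h1 := h.sum_weight_le hd hdeg hK
  obtain ⟨x, hx⟩ := h.connected.1
  by_cases h0 : degreeIn G B x = 0
  · have hB : B = {x} := by
      by_contra hne
      obtain ⟨u, hu, w, hw, -, huw⟩ := h.connected.2 {x} (by simpa using hx) (by simp)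
        (fun e => hne e.symm)
      rw [Finset.mem_singleton] at hu
      subst hu
      have := degreeIn_pos hw huw
      omega
    have : (B.filter fun u => degreeIn G B u < d) = B := by
      refine Finset.filter_true_of_mem fun u hu => ?_
      rw [hB, Finset.mem_singleton] at hu
      subst hu
      omega
    rw [this]
    omega
  · have hpos : ∀ u ∈ B, degreeIn G B u ≠ 0 := by
      intro u hu hu0
      obtain ⟨u', hu', w, hw, -, huw⟩ := h.connected.2 {u} (by simpa using hu) (by simp)
        (fun e => by
          rw [← e, Finset.mem_singleton] at hx
          subst hx
          exact h0 hu0)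
      rw [Finset.mem_singleton] at hu'
      subst hu'
      have := degreeIn_pos hw huw
      omega
    -- Without isolated vertices, a vertex of degree less than `d` weighs at least `-3`; this is the
    -- source of the factor `4`.
    have h2 : ∑ u ∈ B, (if degreeIn G B u < d then (-3 : ℤ) else 1) ≤
        ∑ u ∈ B, weight d (degreeIn G B u) := by
      refine Finset.sum_le_sum fun u hu => ?_
      have := hpos u hu
      have := hdeg u hu
      unfold weight
      split_ifs <;> omega
    rw [Finset.sum_ite] at h2
    simp only [Finset.sum_const, nsmul_eq_mul] at h2
    have h3 := Finset.card_filter_add_card_filter_not (s := B) (fun u => degreeIn G B u < d)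
    omega

end Bad

/-! ### Balls, flexible sets, rich and happy vertices -/

open scoped Classical in
/-- The ball of radius `r` around `v` in the subgraph of `G` induced by `Y`. -/
noncomputable def ball {V : Type*} [DecidableEq V] (G : SimpleGraph V) (Y : Finset V) :
    ℕ → V → Finset V
  | 0, v => {v}
  | r + 1, v => ball G Y r v ∪ Y.filter fun u => ∃ w ∈ ball G Y r v, G.Adj w u

/-- `B` can be colored whenever all lists have `d` colors, of which at most one is lost for every
neighbor in `U` outside of `B`. -/
def Flexible {V : Type*} (C : Type*) (G : SimpleGraph V) (d : ℕ) (U B : Finset V) : Prop :=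
  ∀ L : V → Finset C, (∀ u ∈ B, d + degreeIn G B u ≤ (L u).card + degreeIn G U u) →
    ListColorableOn G B L

/-- The vertices with at most `d` neighbors in `U`. -/
noncomputable def rich {V : Type*} (G : SimpleGraph V) (d : ℕ) (U : Finset V) : Finset V :=
  U.filter fun v => degreeIn G U v ≤ d

open scoped Classical in
/-- The rich vertices with a flexible ball of radius `R`. -/
noncomputable def happy {V : Type*} [DecidableEq V] (C : Type*) (G : SimpleGraph V) (d R : ℕ)
    (U : Finset V) : Finset V :=
  (rich G d U).filter fun v => Flexible C G d U (ball G (rich G d U) R v)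

section Ball

variable {V : Type*} [DecidableEq V] {G : SimpleGraph V} {Y Y' : Finset V}

theorem self_mem_ball (r : ℕ) (v : V) : v ∈ ball G Y r v := by
  induction r with
  | zero => simp [ball]
  | succ r ih => exact Finset.mem_union_left _ ih

theorem mem_ball_succ {r : ℕ} {v u : V} : u ∈ ball G Y (r + 1) v ↔
    u ∈ ball G Y r v ∨ u ∈ Y ∧ ∃ w ∈ ball G Y r v, G.Adj w u := by
  simp [ball]

theorem ball_subset_succ (r : ℕ) (v : V) : ball G Y r v ⊆ ball G Y (r + 1) v :=
  fun _ h => mem_ball_succ.2 (Or.inl h)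

theorem ball_mono {r s : ℕ} (h : r ≤ s) (v : V) : ball G Y r v ⊆ ball G Y s v := by
  induction h with
  | refl => rfl
  | step _ ih => exact ih.trans (ball_subset_succ _ _)

theorem ball_subset {v : V} (hv : v ∈ Y) (r : ℕ) : ball G Y r v ⊆ Y := by
  induction r with
  | zero => simpa [ball] using hv
  | succ r ih =>
    intro u hu
    rcases mem_ball_succ.1 hu with h | h
    · exact ih h
    · exact h.1

theorem ball_mono_set (h : Y ⊆ Y') (r : ℕ) (v : V) : ball G Y r v ⊆ ball G Y' r v := by
  induction r with
  | zero => simp [ball]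
  | succ r ih =>
    intro u hu
    rcases mem_ball_succ.1 hu with h' | ⟨h1, w, hw, hwu⟩
    · exact mem_ball_succ.2 (Or.inl (ih h'))
    · exact mem_ball_succ.2 (Or.inr ⟨h h1, w, ih hw, hwu⟩)

theorem mem_ball_trans {r s : ℕ} {v u w : V} (hu : u ∈ ball G Y r v) (hw : w ∈ ball G Y s u) :
    w ∈ ball G Y (r + s) v := by
  induction s generalizing w with
  | zero =>
    simp only [ball, Finset.mem_singleton] at hw
    exact hw ▸ hu
  | succ s ih =>
    rcases mem_ball_succ.1 hw with h | ⟨h1, x, hx, hxw⟩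
    · exact ball_subset_succ _ _ (ih h)
    · exact mem_ball_succ.2 (Or.inr ⟨h1, x, ih hx, hxw⟩)

theorem mem_ball_one {v u : V} (hu : u ∈ Y) (h : G.Adj v u) : u ∈ ball G Y 1 v :=
  mem_ball_succ.2 (Or.inr ⟨hu, v, self_mem_ball _ _, h⟩)

theorem mem_ball_symm {r : ℕ} {v u : V} (hv : v ∈ Y) (hu : u ∈ ball G Y r v) :
    v ∈ ball G Y r u := by
  induction r generalizing u with
  | zero =>
    simp only [ball, Finset.mem_singleton] at hu ⊢
    exact hu.symm
  | succ r ih =>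
    rcases mem_ball_succ.1 hu with h | ⟨h1, w, hw, hwu⟩
    · exact ball_subset_succ _ _ (ih h)
    · rw [add_comm]
      exact mem_ball_trans (mem_ball_one (ball_subset hv r hw) hwu.symm) (ih hw)

theorem ConnectedOn.of_subset {B B' : Finset V} (hB : ConnectedOn G B) (hBB' : B ⊆ B')
    (h : ∀ u ∈ B', u ∉ B → ∃ w ∈ B, G.Adj w u) : ConnectedOn G B' := by
  refine ⟨hB.1.mono hBB', fun Z hZ hZne hZe => ?_⟩
  by_cases h0 : (Z ∩ B).Nonempty
  · by_cases h1 : B ⊆ Z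
    · obtain ⟨w, hw, hwZ⟩ : ∃ w ∈ B', w ∉ Z := by
        by_contra! hcon
        exact hZe (hZ.antisymm hcon)
      obtain ⟨u, hu, huw⟩ := h w hw (fun hwB => hwZ (h1 hwB))
      exact ⟨u, h1 hu, w, hw, hwZ, huw⟩
    · obtain ⟨u, hu, w, hw, hwn, huw⟩ := hB.2 (Z ∩ B) Finset.inter_subset_right h0
        (fun e => h1 (fun y hy => (Finset.mem_inter.1 (e ▸ hy)).1))
      rw [Finset.mem_inter] at hu hwn
      exact ⟨u, hu.1, w, hBB' hw, fun hwZ => hwn ⟨hwZ, hw⟩, huw⟩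
  · obtain ⟨u, hu⟩ := hZne
    have huB : ∀ w ∈ B, w ∉ Z := fun w hw hwZ => h0 ⟨w, Finset.mem_inter.2 ⟨hwZ, hw⟩⟩
    obtain ⟨w, hw, hwu⟩ := h u (hZ hu) (fun huB' => huB u huB' hu)
    exact ⟨u, hu, w, hBB' hw, huB w hw, hwu.symm⟩

theorem connectedOn_ball (r : ℕ) (v : V) : ConnectedOn G (ball G Y r v) := by
  induction r with
  | zero =>
    refine ⟨⟨v, self_mem_ball _ _⟩, fun W hW hne hW' => ?_⟩
    simp only [ball] at hW hW'
    rcases Finset.subset_singleton_iff.1 hW with h | h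
    · exact (hne.ne_empty h).elim
    · exact (hW' h).elim
  | succ r ih =>
    refine ih.of_subset (ball_subset_succ _ _) fun u hu hn => ?_
    rcases mem_ball_succ.1 hu with h | h
    · exact (hn h).elim
    · exact h.2

theorem rich_subset {d : ℕ} {U : Finset V} : rich G d U ⊆ U := Finset.filter_subset _ _

theorem degreeIn_le_of_mem_rich {d : ℕ} {U : Finset V} {v : V} (h : v ∈ rich G d U) : degreeIn G U v ≤ d :=
  (Finset.mem_filter.1 h).2

theorem mem_happy {C : Type*} {d R : ℕ} {U : Finset V} {v : V} : v ∈ happy C G d R U ↔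
    v ∈ rich G d U ∧ Flexible C G d U (ball G (rich G d U) R v) := by
  classical
  exact Finset.mem_filter

theorem happy_subset {C : Type*} {d R : ℕ} {U : Finset V} : happy C G d R U ⊆ rich G d U := fun _ h => (mem_happy.1 h).1

end Ball

/-! ### Many vertices are happy -/

section Count

variable {V : Type*} [DecidableEq V] {C : Type*} [Nonempty C] {G : SimpleGraph V} {d : ℕ}
  {U : Finset V}

/-- Color `B' \ B` first, moving toward `B`, so that every vertex there has a neighbor that is not
yet colored. Then a vertex of `B` has lost at most one color per neighbor in `B' \ B`, which is
exactly the loss that a flexible set tolerates. -/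
theorem Flexible.of_subset {B B' : Finset V} (h : Flexible C G d U B) (hBB' : B ⊆ B')
    (hB : B.Nonempty) (hB' : ConnectedOn G B') (hd : ∀ u ∈ B', degreeIn G U u ≤ d) :
    Flexible C G d U B' := by
  classical
  intro L hL
  obtain ⟨ρ, hρ⟩ := hB'.exists_rank hB hBB'
  obtain ⟨c₀, h1, h2⟩ : ListColorableOn G (B' \ B) L := by
    refine listColorableOn_of_rank ρ _ L fun u hu => ?_
    obtain ⟨huB', huB⟩ := Finset.mem_sdiff.1 hu
    have hsum := degreeIn_add_sdiff (G := G) hBB' u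
    have := hL u huB'
    have := hd u huB'
    obtain ⟨w, hw, huw, hlt⟩ := hρ u huB' huB
    by_cases hwB : w ∈ B
    · left
      have := degreeIn_pos hwB huw
      omega
    · exact Or.inr ⟨by omega, w, Finset.mem_sdiff.2 ⟨hw, hwB⟩, huw, hlt⟩
  obtain ⟨c₁, h3, h4⟩ := h (fun u => L u \ ((B' \ B).filter (G.Adj u)).image c₀) (by
    intro u hu
    have hsum := degreeIn_add_sdiff (G := G) hBB' u
    have h5 := hL u (hBB' hu)
    have h6 : (((B' \ B).filter (G.Adj u)).image c₀).card ≤ degreeIn G (B' \ B) u :=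
      Finset.card_image_le.trans (le_of_eq (by unfold degreeIn; congr))
    have h7 := Finset.le_card_sdiff (((B' \ B).filter (G.Adj u)).image c₀) (L u)
    omega)
  have hcross : ∀ u ∈ B, ∀ w ∈ B', w ∉ B → G.Adj u w → c₁ u ≠ c₀ w := by
    intro u hu w hw hwB huw e
    have := (Finset.mem_sdiff.1 (h3 u hu)).2
    exact this (Finset.mem_image.2 ⟨w, Finset.mem_filter.2
      ⟨Finset.mem_sdiff.2 ⟨hw, hwB⟩, huw⟩, e.symm⟩)
  refine ⟨fun u => if u ∈ B then c₁ u else c₀ u, fun u hu => ?_, fun u hu w hw huw => ?_⟩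
  · dsimp only
    split_ifs with huB
    · exact (Finset.mem_sdiff.1 (h3 u huB)).1
    · exact h1 u (Finset.mem_sdiff.2 ⟨hu, huB⟩)
  · dsimp only
    split_ifs with huB hwB hwB
    · exact h4 u huB w hwB huw
    · exact hcross u huB w hw hwB huw
    · exact (hcross w hwB u hu huB huw.symm).symm
    · exact h2 u (Finset.mem_sdiff.2 ⟨hu, huB⟩) w (Finset.mem_sdiff.2 ⟨hw, hwB⟩) huw

/-- Connected sets near a vertex that is not happy are bad, and have no vertex of small degree. -/
theorem exists_isBad {R : ℕ} {v : V} (hv : v ∈ rich G d U) (hv' : v ∉ happy C G d R U)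
    {B : Finset V} (hB : ConnectedOn G B) (hBR : B ⊆ ball G (rich G d U) R v) :
    (∃ L : V → Finset C, IsBad G B L) ∧ ∀ u ∈ B, degreeIn G U u = d := by
  have hnf : ¬ Flexible C G d U (ball G (rich G d U) R v) := fun h =>
    hv' (mem_happy.2 ⟨hv, h⟩)
  have hrich : ∀ u ∈ ball G (rich G d U) R v, degreeIn G U u ≤ d := fun u hu =>
    degreeIn_le_of_mem_rich (ball_subset hv R hu)
  -- With fewer than `d` neighbors in `U`, a vertex would have a spare color for all admissible
  -- lists, and the whole ball would be flexible.
  have hdeg : ∀ u ∈ ball G (rich G d U) R v, degreeIn G U u = d := by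
    intro u hu
    by_contra hne
    have hlt := lt_of_le_of_ne (hrich u hu) hne
    refine hnf fun L hL => (connectedOn_ball R v).listColorableOn (fun w hw => ?_) hu ?_
    · have := hL w hw
      have := hrich w hw
      omega
    · have := hL u hu
      omega
  refine ⟨?_, fun u hu => hdeg u (hBR hu)⟩
  have hnB : ¬ Flexible C G d U B := fun h =>
    hnf (h.of_subset hBR hB.1 (connectedOn_ball R v) hrich)
  unfold Flexible at hnB
  push Not at hnB
  obtain ⟨L, hL, hLn⟩ := hnB
  refine ⟨L, hB, fun u hu => ?_, hLn⟩
  have := hL u hu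
  have := hdeg u (hBR hu)
  omega

/-- `IsBad.card_le` for the ball of radius `r + 1`. The smaller ball has all its `Y`-neighbors in
the larger one, so a vertex of low degree in the larger ball lies on the sphere or has low degree in
`Y`. The sphere is counted on the left as well, whence `3` instead of `4`. -/
theorem card_ball_le {R r : ℕ} (hd : 3 ≤ d) (hK : ∀ Q ⊆ U, ¬ G.IsNClique (d + 1) Q)
    {Y : Finset V} (hY : Y ⊆ rich G d U \ happy C G d R U) {v : V} (hv : v ∈ Y) (hr : r + 1 ≤ R) :
    (ball G Y r v).card ≤ 3 * (ball G Y (r + 1) v \ ball G Y r v).card +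
      4 * ((ball G Y r v).filter fun u => degreeIn G Y u < d).card := by
  obtain ⟨hvr, hvh⟩ := Finset.mem_sdiff.1 (hY hv)
  have hYr : Y ⊆ rich G d U := hY.trans Finset.sdiff_subset
  have hsub : ball G Y (r + 1) v ⊆ Y := ball_subset hv _
  obtain ⟨⟨L, hL⟩, hdeg⟩ := exists_isBad hvr hvh (connectedOn_ball (G := G) (Y := Y) (r + 1) v)
    ((ball_mono hr v).trans (ball_mono_set hYr R v))
  have h1 := hL.card_le hd
    (fun u hu => (degreeIn_mono (hsub.trans (hYr.trans rich_subset)) u).trans (hdeg u hu).le)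
    (fun Q hQ => hK Q (hQ.trans (hsub.trans (hYr.trans rich_subset))))
  have h2 : (ball G Y (r + 1) v).filter (fun u => degreeIn G (ball G Y (r + 1) v) u < d) ⊆
      (ball G Y (r + 1) v \ ball G Y r v) ∪
        (ball G Y r v).filter fun u => degreeIn G Y u < d := by
    intro u hu
    obtain ⟨hu1, hu2⟩ := Finset.mem_filter.1 hu
    by_cases hur : u ∈ ball G Y r v
    · refine Finset.mem_union_right _ (Finset.mem_filter.2 ⟨hur, ?_⟩)
      rwa [degreeIn_congr fun w huw => ⟨fun hw => hsub hw, fun hw =>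
        mem_ball_succ.2 (Or.inr ⟨hw, u, hur, huw⟩)⟩] at hu2
    · exact Finset.mem_union_left _ (Finset.mem_sdiff.2 ⟨hu1, hur⟩)
  have h3 := (Finset.card_le_card h2).trans (Finset.card_union_le _ _)
  have h4 := Finset.card_sdiff_add_card_eq_card (ball_subset_succ (G := G) (Y := Y) r v)
  omega

/-- Some ball grows slowly. -/
theorem exists_card_sphere_le {R : ℕ} {Y : Finset V} (hR : 14 ^ R * Y.card < 15 ^ R) {v : V}
    (hv : v ∈ Y) : ∃ r, r + 1 ≤ R ∧
      14 * (ball G Y (r + 1) v \ ball G Y r v).card ≤ (ball G Y r v).card := by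
  by_contra! hcon
  -- If every sphere were larger, each step would enlarge the ball by a factor `15 / 14`, and the
  -- ball of radius `R` would not fit into `Y`.
  have key : ∀ r ≤ R, 15 ^ r ≤ 14 ^ r * (ball G Y r v).card := by
    intro r
    induction r with
    | zero => intro _; simp [ball]
    | succ r ih =>
      intro hr
      have h1 := ih (by omega)
      have h2 := hcon r hr
      have h3 := Finset.card_sdiff_add_card_eq_card (ball_subset_succ (G := G) (Y := Y) r v)
      have h4 : 15 * (ball G Y r v).card ≤ 14 * (ball G Y (r + 1) v).card := by omega
      calc 15 ^ (r + 1) = 15 ^ r * 15 := pow_succ _ _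
        _ ≤ 14 ^ r * (ball G Y r v).card * 15 := Nat.mul_le_mul_right _ h1
        _ = 14 ^ r * (15 * (ball G Y r v).card) := by ring
        _ ≤ 14 ^ r * (14 * (ball G Y (r + 1) v).card) := Nat.mul_le_mul_left _ h4
        _ = 14 ^ (r + 1) * (ball G Y (r + 1) v).card := by ring
  have h1 := key R le_rfl
  have h2 := Finset.card_le_card (ball_subset (G := G) hv R)
  have := Nat.mul_le_mul_left (14 ^ R) h2
  omega

/-- Cut off a ball `B` with a small sphere `S` and use induction on `Y \ B`, where only the vertices
of `S` have lost neighbors. If `ℓ` counts the vertices of low degree in `Y`, then `|B| ≤ 3|S| +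
4ℓ(B)` and `|Y \ B| ≤ 8|S| + 8ℓ(Y \ B)`. Twice the first plus the second gives the claim because
`14|S| ≤ |B|`; this is where `14` comes from. -/
theorem card_le_of_not_happy {R : ℕ} (hd : 3 ≤ d) (hK : ∀ Q ⊆ U, ¬ G.IsNClique (d + 1) Q)
    (hR : 14 ^ R * U.card < 15 ^ R) {Y : Finset V} (hY : Y ⊆ rich G d U \ happy C G d R U) :
    Y.card ≤ 8 * (Y.filter fun u => degreeIn G Y u < d).card := by
  induction hn : Y.card using Nat.strong_induction_on generalizing Y with
  | _ n ih =>
  rcases Y.eq_empty_or_nonempty with rfl | ⟨v, hv⟩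
  · simp at hn; omega
  have hYU : Y ⊆ U := hY.trans (Finset.sdiff_subset.trans rich_subset)
  obtain ⟨r, hr, hs⟩ := exists_card_sphere_le (G := G)
    ((Nat.mul_le_mul_left _ (Finset.card_le_card hYU)).trans_lt hR) hv
  have h1 := card_ball_le hd hK hY hv hr
  have hBY : ball G Y r v ⊆ Y := ball_subset hv r
  have hcard := Finset.card_sdiff_add_card_eq_card hBY
  have hpos : 0 < (ball G Y r v).card := Finset.card_pos.2 ⟨v, self_mem_ball r v⟩
  have h2 := ih _ (by omega) (Y := Y \ ball G Y r v) (Finset.sdiff_subset.trans hY) rfl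
  have h3 : (Y \ ball G Y r v).filter (fun u => degreeIn G (Y \ ball G Y r v) u < d) ⊆
      (ball G Y (r + 1) v \ ball G Y r v) ∪
        (Y \ ball G Y r v).filter (fun u => degreeIn G Y u < d) := by
    intro u hu
    obtain ⟨hu1, hu2⟩ := Finset.mem_filter.1 hu
    obtain ⟨huY, huB⟩ := Finset.mem_sdiff.1 hu1
    by_cases hadj : ∃ w ∈ ball G Y r v, G.Adj w u
    · exact Finset.mem_union_left _ (Finset.mem_sdiff.2
        ⟨mem_ball_succ.2 (Or.inr ⟨huY, hadj⟩), huB⟩)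
    · refine Finset.mem_union_right _ (Finset.mem_filter.2 ⟨hu1, ?_⟩)
      rwa [degreeIn_congr (W' := Y) fun w huw => ⟨fun hw => Finset.sdiff_subset hw, fun hw =>
        Finset.mem_sdiff.2 ⟨hw, fun hwB => hadj ⟨w, hwB, huw.symm⟩⟩⟩] at hu2
  have h4 := (Finset.card_le_card h3).trans (Finset.card_union_le _ _)
  have h5 : (Y.filter fun u => degreeIn G Y u < d).card =
      ((ball G Y r v).filter fun u => degreeIn G Y u < d).card +
        ((Y \ ball G Y r v).filter fun u => degreeIn G Y u < d).card := by
    rw [← Finset.card_union_of_disjoint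
      (Finset.disjoint_filter_filter Finset.disjoint_sdiff), ← Finset.filter_union,
      Finset.union_sdiff_of_subset hBY]
  omega

theorem sum_degreeIn_comm (W W' : Finset V) :
    ∑ u ∈ W, degreeIn G W' u = ∑ w ∈ W', degreeIn G W w := by
  classical
  have := Finset.sum_card_bipartiteAbove_eq_sum_card_bipartiteBelow (s := W) (t := W') G.Adj
  simp only [Finset.bipartiteAbove, Finset.bipartiteBelow] at this
  have h : ∀ w, W.filter (fun a => G.Adj a w) = W.filter (G.Adj w) := fun w =>
    Finset.filter_congr fun a _ => G.adj_comm a w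
  simp only [h] at this
  unfold degreeIn
  convert this

/-- A sad vertex has exactly `d` neighbors in `U`. If it has fewer among the sad vertices, then one
of its edges goes to a happy or a poor vertex, and these edges are counted at their other ends. -/
theorem card_sad_le {R : ℕ} (hd : 3 ≤ d) (hK : ∀ Q ⊆ U, ¬ G.IsNClique (d + 1) Q)
    (hR : 14 ^ R * U.card < 15 ^ R) :
    (rich G d U \ happy C G d R U).card ≤ 8 * (∑ w ∈ happy C G d R U, degreeIn G U w +
      ∑ w ∈ U \ rich G d U, degreeIn G U w) := by
  set S := rich G d U \ happy C G d R U with hS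
  have hSU : S ⊆ U := Finset.sdiff_subset.trans rich_subset
  have hU : U \ S = happy C G d R U ∪ (U \ rich G d U) := by
    ext u
    have h1 : u ∈ happy C G d R U → u ∈ rich G d U := fun h => happy_subset h
    have h2 : u ∈ rich G d U → u ∈ U := fun h => rich_subset h
    simp only [hS, Finset.mem_sdiff, Finset.mem_union]
    tauto
  have hdisj : Disjoint (happy C G d R U) (U \ rich G d U) :=
    Finset.disjoint_sdiff.mono_left happy_subset
  refine (card_le_of_not_happy hd hK hR subset_rfl).trans (Nat.mul_le_mul_left _ ?_)
  rw [← Finset.sum_union hdisj, ← hU]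
  calc (S.filter fun u => degreeIn G S u < d).card
      ≤ ∑ u ∈ S.filter (fun u => degreeIn G S u < d), degreeIn G (U \ S) u := by
        rw [Finset.card_eq_sum_ones]
        refine Finset.sum_le_sum fun u hu => ?_
        obtain ⟨huS, hu⟩ := Finset.mem_filter.1 hu
        obtain ⟨hur, huh⟩ := Finset.mem_sdiff.1 huS
        have h1 := (exists_isBad hur huh (connectedOn_ball R u) subset_rfl).2 u
          (self_mem_ball R u)
        have := degreeIn_add_sdiff (G := G) hSU u
        omega
    _ ≤ ∑ u ∈ S, degreeIn G (U \ S) u :=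
        Finset.sum_le_sum_of_subset (Finset.filter_subset _ _)
    _ = ∑ w ∈ U \ S, degreeIn G S w := sum_degreeIn_comm _ _
    _ ≤ ∑ w ∈ U \ S, degreeIn G U w := Finset.sum_le_sum fun w _ => degreeIn_mono hSU w

/-- There are no poor vertices, and a happy vertex receives at most `d` of the counted edges;
finally `8 * d + 1 ≤ 9 * d`. -/
theorem card_le_happy_of_degree_le {R : ℕ} (hd : 3 ≤ d)
    (hK : ∀ Q ⊆ U, ¬ G.IsNClique (d + 1) Q) (hR : 14 ^ R * U.card < 15 ^ R)
    (hdeg : ∀ u ∈ U, degreeIn G U u ≤ d) :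
    U.card ≤ (9 * d) * (happy C G d R U).card := by
  have hr : rich G d U = U := Finset.filter_true_of_mem hdeg
  have h1 := card_sad_le (C := C) hd hK hR
  have h2 : ∑ w ∈ happy C G d R U, degreeIn G U w ≤ (happy C G d R U).card * d :=
    (Finset.sum_le_sum fun w hw => degreeIn_le_of_mem_rich (happy_subset hw)).trans (by simp)
  have h3 := Finset.card_sdiff_add_card_eq_card (happy_subset (C := C) (G := G) (d := d)
    (R := R) (U := U))
  rw [hr] at h1 h3
  rw [Finset.sdiff_self, Finset.sum_empty, add_zero] at h1
  nlinarith

/-- In the total budget of `d` per vertex, sad vertices use exactly their share and poor vertices at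
least one more than theirs. The excess has to be saved by the happy vertices, at most `d` at each,
which bounds both the number and the degree sum of the poor vertices. -/
theorem card_le_happy {R : ℕ} (hd : 3 ≤ d) (hK : ∀ Q ⊆ U, ¬ G.IsNClique (d + 1) Q)
    (hR : 14 ^ R * U.card < 15 ^ R) (hsum : ∑ u ∈ U, degreeIn G U u ≤ d * U.card) :
    U.card ≤ (14 * d ^ 2) * (happy C G d R U).card := by
  have h1 := card_sad_le (C := C) hd hK hR
  set A := happy C G d R U
  set S := rich G d U \ A
  set P := U \ rich G d U
  have h2 : ∑ w ∈ A, degreeIn G U w ≤ A.card * d :=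
    (Finset.sum_le_sum fun w hw => degreeIn_le_of_mem_rich (happy_subset hw)).trans
      (le_of_eq (by rw [Finset.sum_const, smul_eq_mul]))
  have h3 : S.card + A.card = (rich G d U).card :=
    Finset.card_sdiff_add_card_eq_card happy_subset
  have h4 : P.card + (rich G d U).card = U.card :=
    Finset.card_sdiff_add_card_eq_card rich_subset
  have h5 : ∑ u ∈ P, degreeIn G U u + (∑ u ∈ S, degreeIn G U u + ∑ u ∈ A, degreeIn G U u) =
      ∑ u ∈ U, degreeIn G U u := by
    rw [Finset.sum_sdiff happy_subset, Finset.sum_sdiff rich_subset]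
  have h6 : ∑ u ∈ S, degreeIn G U u = S.card * d := by
    rw [Finset.sum_const_nat]
    intro u hu
    obtain ⟨hur, huh⟩ := Finset.mem_sdiff.1 hu
    exact (exists_isBad hur huh (connectedOn_ball R u) subset_rfl).2 u (self_mem_ball R u)
  have h7 : P.card * (d + 1) ≤ ∑ u ∈ P, degreeIn G U u := by
    rw [← smul_eq_mul, ← Finset.sum_const]
    refine Finset.sum_le_sum fun u hu => ?_
    obtain ⟨huU, hur⟩ := Finset.mem_sdiff.1 hu
    by_contra hlt
    exact hur (Finset.mem_filter.2 ⟨huU, by omega⟩)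
  set x := ∑ u ∈ P, degreeIn G U u
  set y := ∑ u ∈ A, degreeIn G U u
  have h8 : x ≤ d * P.card + d * A.card := by nlinarith
  have h9 : P.card ≤ d * A.card := by nlinarith
  have h10 : d * P.card ≤ d * (d * A.card) := Nat.mul_le_mul_left _ h9
  -- The factor equals `8 d ^ 2 + 17 d + 1`, which is at most `14 d ^ 2` for `d ≥ 3`.
  have h11 : U.card ≤ (1 + d + 8 * (d + (d * d + d))) * A.card := by nlinarith
  refine h11.trans (Nat.mul_le_mul_right _ ?_)
  nlinarith

end Count

/-! ### The coloring procedure, as a function of the network -/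

section Definitions

variable {V : Type*} [DecidableEq V] {C : Type*}

open scoped Classical in
/-- An element of a finite set, chosen depending on the set only. -/
noncomputable def pick {α : Type*} (F : Finset α) : Option α :=
  if h : F.Nonempty then some h.choose else none

open scoped Classical in
/-- The colors of the list of `v` that do not appear on its neighbors. -/
noncomputable def avail (G : SimpleGraph V) (L : V → Finset C) (c : V → Option C) (v : V) :
    Finset C :=
  (L v).filter fun x => ∀ w, G.Adj v w → c w ≠ some x

/-- The vertices of `D` choose a color one after the other, at the time given by their key. -/
noncomputable def greedy (G : SimpleGraph V) (L : V → Finset C) (D : Finset V) (key : V → ℕ)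
    (c₀ : V → Option C) : ℕ → V → Option C
  | 0 => c₀
  | t + 1 => fun v =>
      if v ∈ D ∧ key v = t then pick (avail G L (greedy G L D key c₀ t) v)
      else greedy G L D key c₀ t v

open scoped Classical in
/-- A ruling set in the subgraph induced by `Y`, computed from `A` bit by bit of the identifiers
`ν`: two classes of identifiers that differ in one bit are merged by removing the vertices of the
upper class that are close to a vertex of the lower class. -/
noncomputable def ruling (G : SimpleGraph V) (Y : Finset V) (ν : V → ℕ) (α : ℕ) (A : Finset V) :
    ℕ → Finset V
  | 0 => A
  | j + 1 => (ruling G Y ν α A j).filter fun q => ∀ q' ∈ ruling G Y ν α A j, q' ∈ ball G Y α q →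
      ν q' / 2 ^ (j + 1) = ν q / 2 ^ (j + 1) → ¬ ν q' / 2 ^ j < ν q / 2 ^ j

/-- The edges of `G` between vertices whose identifiers agree up to the last `k` bits. -/
def classGraph (G : SimpleGraph V) (ν : V → ℕ) (k : ℕ) : SimpleGraph V where
  Adj u w := G.Adj u w ∧ ν u / 2 ^ k = ν w / 2 ^ k
  symm := ⟨fun _ _ h => ⟨h.1.symm, h.2.symm⟩⟩
  loopless := ⟨fun _ h => G.loopless.irrefl _ h.1⟩

/-- A coloring of the subgraph induced by `Y` with `d + 1` colors, computed bit by bit of the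
identifiers `ν`. -/
noncomputable def schedule (G : SimpleGraph V) (Y : Finset V) (ν : V → ℕ) (d : ℕ) : ℕ → V → ℕ
  | 0, _ => 0
  | j + 1, v =>
      (greedy (classGraph G ν (j + 1)) (fun _ => Finset.range (d + 1)) Y
        (fun u => schedule G Y ν d j u + (d + 1) * (ν u / 2 ^ j % 2)) (fun _ => none)
        (2 * (d + 1)) v).getD 0

/-- Some vertex of `Q` is within distance `r` from `v` in the subgraph induced by `Y`. -/
def Near (G : SimpleGraph V) (Y Q : Finset V) (r : ℕ) (v : V) : Prop := ∃ q ∈ Q, q ∈ ball G Y r v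

open scoped Classical in
/-- The distance of `v` from `Q`, truncated at `b`. -/
noncomputable def layer (G : SimpleGraph V) (Y Q : Finset V) (b : ℕ) (v : V) : ℕ :=
  ((Finset.range b).filter fun r => ¬ Near G Y Q r v).card

/-- The edges of `G` inside `B`. -/
def restrict (G : SimpleGraph V) (B : Finset V) : SimpleGraph V where
  Adj u w := G.Adj u w ∧ u ∈ B ∧ w ∈ B
  symm := ⟨fun _ _ h => ⟨h.1.symm, h.2.2, h.2.1⟩⟩
  loopless := ⟨fun _ h => G.loopless.irrefl _ h.1⟩

open scoped Classical in
/-- A coloring of `B`, if there is one. -/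
noncomputable def solve (G : SimpleGraph V) (B : Finset V) (L : V → Finset C) (v : V) : Option C :=
  if h : ListColorableOn G B L then some (h.choose v) else none

open scoped Classical in
/-- The vertices of `Q` whose ball of radius `R` contains `v`. -/
noncomputable def centers (G : SimpleGraph V) (Y : Finset V) (R : ℕ) (Q : Finset V) (v : V) :
    Finset V :=
  Q.filter fun q => v ∈ Y ∧ q ∈ ball G Y R v

/-- The coloring of the ball of radius `R` around `q`, given the coloring `c` of its outside. -/
noncomputable def ballColoring (G : SimpleGraph V) (L : V → Finset C) (Y : Finset V) (R : ℕ)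
    (c : V → Option C) (q : V) : V → Option C :=
  -- Edges and lists outside of the ball are erased, so that the arbitrary choice in `solve` depends
  -- only on data of the ball. All vertices of the ball then make the same choice.
  solve (restrict G (ball G Y R q)) (ball G Y R q)
    (fun u => if u ∈ ball G Y R q then avail G L c u else ∅)

/-- Color the balls of radius `R` around the vertices of `Q`. -/
noncomputable def finish (G : SimpleGraph V) (L : V → Finset C) (Y : Finset V) (R : ℕ)
    (Q : Finset V) (c : V → Option C) (v : V) : Option C :=
  (pick (centers G Y R Q v)).elim (c v) fun q => ballColoring G L Y R c q v

variable (C) in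
/-- The centers of the clusters that are removed together from `U`. -/
noncomputable def roots (G : SimpleGraph V) (ν : V → ℕ) (d R m : ℕ) (U : Finset V) : Finset V :=
  -- With separation `2 * R + 1`, the balls of radius `R` around distinct roots are disjoint and no
  -- edge joins them.
  ruling G (rich G d U) ν (2 * R + 1) (happy C G d R U) m

open scoped Classical in
variable (C) in
/-- The vertices that are removed from `U` in one phase. -/
noncomputable def removed (G : SimpleGraph V) (ν : V → ℕ) (d R m : ℕ) (U : Finset V) : Finset V :=
  -- The radius is the domination radius of the ruling set, `2 * R + 1` for each bit, so that all
  -- happy vertices are removed.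
  (rich G d U).filter (Near G (rich G d U) (roots C G ν d R m U) ((2 * R + 1) * m))

variable (C) in
/-- What is left of `U` after one phase. -/
noncomputable def peel (G : SimpleGraph V) (ν : V → ℕ) (d R m : ℕ) (U : Finset V) : Finset V :=
  U \ removed C G ν d R m U

open scoped Classical in
variable (C) in
/-- The removed vertices outside of the balls of radius `R` around the roots. -/
noncomputable def outer (G : SimpleGraph V) (ν : V → ℕ) (d R m : ℕ) (U : Finset V) : Finset V :=
  (removed C G ν d R m U).filter fun v => ¬ Near G (rich G d U) (roots C G ν d R m U) R v

variable (C) in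
/-- The time when a vertex outside of the balls around the roots is colored. -/
noncomputable def colorTime (G : SimpleGraph V) (ν : V → ℕ) (d R m : ℕ) (U : Finset V) (v : V) :
    ℕ :=
  -- Farther layers come first, and each layer has `d + 1` consecutive time slots, one for each
  -- color of the schedule.
  ((2 * R + 1) * m - layer G (rich G d U) (roots C G ν d R m U) ((2 * R + 1) * m) v) * (d + 1) +
    schedule G (rich G d U) ν d m v

/-- Extend a coloring of `peel U` to `U`. -/
noncomputable def extend (G : SimpleGraph V) (ν : V → ℕ) (d R m : ℕ) (L : V → Finset C)
    (U : Finset V) (c : V → Option C) : V → Option C :=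
  finish G L (rich G d U) R (roots C G ν d R m U)
    (greedy G L (outer C G ν d R m U) (colorTime C G ν d R m U) c
      (((2 * R + 1) * m + 1) * (d + 1)))

/-- The coloring of `U` computed in `k` phases. -/
noncomputable def coloring (G : SimpleGraph V) (ν : V → ℕ) (d R m : ℕ) (L : V → Finset C) :
    ℕ → Finset V → V → Option C
  | 0, _ => fun _ => none
  | k + 1, U => extend G ν d R m L U (coloring G ν d R m L k (peel C G ν d R m U))

/-- `c` is a proper coloring from the lists `L` of exactly the vertices of `W`. -/
structure IsPartialColoring (G : SimpleGraph V) (L : V → Finset C) (W : Finset V)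
    (c : V → Option C) : Prop where
  ne_none_iff : ∀ v, c v ≠ none ↔ v ∈ W
  mem_list : ∀ v x, c v = some x → x ∈ L v
  proper : ∀ u w x, G.Adj u w → c u = some x → c w ≠ some x

end Definitions

/-! ### Correctness of a phase and of the coloring -/

section Correctness

variable {V : Type*} [DecidableEq V] {C : Type*} {G : SimpleGraph V} {L : V → Finset C}

theorem pick_eq_none {α : Type*} {F : Finset α} : pick F = none ↔ F = ∅ := by
  unfold pick
  split_ifs with h
  · simp [h.ne_empty]
  · simpa using Finset.not_nonempty_iff_eq_empty.1 h

theorem mem_of_pick_eq {α : Type*} {F : Finset α} {x : α} (h : pick F = some x) : x ∈ F := by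
  unfold pick at h
  split_ifs at h with h'
  rw [← Option.some.inj h]
  exact h'.choose_spec

theorem mem_avail {c : V → Option C} {v : V} {x : C} : x ∈ avail G L c v ↔
    x ∈ L v ∧ ∀ w, G.Adj v w → c w ≠ some x := by
  classical
  exact Finset.mem_filter

/-- Only the neighbors that are colored make colors unavailable. -/
theorem card_le_card_avail_add {c : V → Option C} {W : Finset V} {v : V}
    (h : ∀ w, G.Adj v w → c w ≠ none → w ∈ W) :
    (L v).card ≤ (avail G L c v).card + degreeIn G W v := by
  classical
  have h1 : L v ⊆ avail G L c v ∪ ((W.filter (G.Adj v)).image c).filterMap id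
      (fun a b x hx hx' => by
        simp only [id_eq, Option.mem_def] at hx hx'; rw [hx, hx']) := by
    intro x hx
    by_cases hav : x ∈ avail G L c v
    · exact Finset.mem_union_left _ hav
    · rw [mem_avail] at hav
      push Not at hav
      obtain ⟨w, hvw, hw⟩ := hav hx
      refine Finset.mem_union_right _ ?_
      rw [Finset.mem_filterMap]
      exact ⟨some x, Finset.mem_image.2 ⟨w, Finset.mem_filter.2
        ⟨h w hvw (by rw [hw]; simp), hvw⟩, hw⟩, rfl⟩
  refine (Finset.card_le_card h1).trans ((Finset.card_union_le _ _).trans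
    (Nat.add_le_add_left ?_ _))
  have h2 : (((W.filter (G.Adj v)).image c).filterMap id
      (fun a b x hx hx' => by
        simp only [id_eq, Option.mem_def] at hx hx'; rw [hx, hx'])).card ≤
      ((W.filter (G.Adj v)).image c).card := by
    rw [← Finset.card_map Function.Embedding.some]
    refine Finset.card_le_card fun y hy => ?_
    simp only [Finset.mem_map, Finset.mem_filterMap, Function.Embedding.some_apply] at hy
    obtain ⟨a, ⟨b, hb, hba⟩, rfl⟩ := hy
    simp only [id_eq] at hba
    exact hba ▸ hb
  refine h2.trans (Finset.card_image_le.trans (le_of_eq ?_))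
  unfold degreeIn
  congr

/-- At the turn of `v` only `W` and the vertices with smaller keys are colored, so `hcard` leaves a
color; vertices that act at the same time are not adjacent by `hkey`. -/
theorem greedy_spec {W D : Finset V} {key : V → ℕ} {c₀ : V → Option C}
    (hc₀ : IsPartialColoring G L W c₀)
    (hkey : ∀ u ∈ D, ∀ w ∈ D, G.Adj u w → key u ≠ key w)
    (hcard : ∀ v ∈ D, degreeIn G (W ∪ D.filter fun w => key w < key v) v < (L v).card) (t : ℕ) :
    IsPartialColoring G L (W ∪ D.filter fun w => key w < t) (greedy G L D key c₀ t) := by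
  induction t with
  | zero => simpa [greedy] using hc₀
  | succ t ih =>
    have hnew : ∀ v ∈ D, key v = t → pick (avail G L (greedy G L D key c₀ t) v) ≠ none := by
      intro v hv hvt hn
      have h1 := hcard v hv
      rw [hvt] at h1
      have h2 := card_le_card_avail_add (L := L) (fun w (_ : G.Adj v w) hw =>
        (ih.ne_none_iff w).1 hw)
      rw [pick_eq_none.1 hn, Finset.card_empty] at h2
      omega
    refine ⟨fun v => ?_, fun v x hx => ?_, fun u w x huw hu hw => ?_⟩
    · simp only [greedy, Finset.mem_union, Finset.mem_filter]
      split_ifs with h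
      · refine ⟨fun _ => Or.inr ⟨h.1, by omega⟩, fun _ => hnew v h.1 h.2⟩
      · rw [ih.ne_none_iff v, Finset.mem_union, Finset.mem_filter]
        refine or_congr_right (and_congr_right fun hv => ?_)
        have : key v ≠ t := fun e => h ⟨hv, e⟩
        omega
    · simp only [greedy] at hx
      split_ifs at hx with h
      · exact (mem_avail.1 (mem_of_pick_eq hx)).1
      · exact ih.mem_list v x hx
    · simp only [greedy] at hu hw
      split_ifs at hu hw with h1 h2 h2
      · exact hkey u h1.1 w h2.1 huw (h1.2.trans h2.2.symm)
      · exact (mem_avail.1 (mem_of_pick_eq hu)).2 w huw hw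
      · exact (mem_avail.1 (mem_of_pick_eq hw)).2 u huw.symm hu
      · exact ih.proper u w x huw hu hw

theorem isPartialColoring_none : IsPartialColoring G L ∅ (fun _ => none) :=
  ⟨by simp, by simp, by simp⟩

/-- Classes of identifiers start as single vertices and are merged in pairs. Shifting the palette of
one class of a pair by `d + 1` gives a proper coloring of the union with `2 * (d + 1)` colors, which
serves as a timetable for recoloring greedily with `d + 1` colors. -/
theorem schedule_spec {Y : Finset V} {ν : V → ℕ} {d : ℕ} (hν : Function.Injective ν)
    (hY : ∀ v ∈ Y, degreeIn G Y v ≤ d) (j : ℕ) :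
    (∀ v ∈ Y, schedule G Y ν d j v < d + 1) ∧
      ∀ u ∈ Y, ∀ w ∈ Y, G.Adj u w → ν u / 2 ^ j = ν w / 2 ^ j →
        schedule G Y ν d j u ≠ schedule G Y ν d j w := by
  classical
  induction j with
  | zero =>
    refine ⟨fun v _ => by simp [schedule], fun u _ w _ huw h => ?_⟩
    simp only [pow_zero, Nat.div_one] at h
    exact (huw.ne (hν h)).elim
  | succ j ih =>
    have hb : ∀ v ∈ Y, schedule G Y ν d j v + (d + 1) * (ν v / 2 ^ j % 2) < 2 * (d + 1) := by
      intro v hv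
      have h1 := ih.1 v hv
      have h2 : ν v / 2 ^ j % 2 < 2 := Nat.mod_lt _ (by norm_num)
      rcases (by omega : ν v / 2 ^ j % 2 = 0 ∨ ν v / 2 ^ j % 2 = 1) with h | h <;> rw [h] <;> omega
    have key := greedy_spec (G := classGraph G ν (j + 1)) (L := fun _ => Finset.range (d + 1))
      (W := ∅) (D := Y) (key := fun u => schedule G Y ν d j u + (d + 1) * (ν u / 2 ^ j % 2))
      isPartialColoring_none
      (by
        intro u hu w hw huw e
        obtain ⟨hadj, hcl⟩ := huw
        have h1 := ih.1 u hu
        have h2 := ih.1 w hw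
        rw [pow_succ, ← Nat.div_div_eq_div_mul, ← Nat.div_div_eq_div_mul] at hcl
        have h3 := ih.2 u hu w hw hadj
        rcases (by omega : ν u / 2 ^ j % 2 = 0 ∨ ν u / 2 ^ j % 2 = 1) with h | h <;>
          rcases (by omega : ν w / 2 ^ j % 2 = 0 ∨ ν w / 2 ^ j % 2 = 1) with h' | h' <;>
          simp only [h, h', mul_zero, mul_one, add_zero] at e
        · exact h3 (by omega) e
        · omega
        · omega
        · exact h3 (by omega) (by omega))
      (by
        intro v hv
        rw [Finset.card_range, Finset.empty_union]
        refine Nat.lt_succ_of_le (le_trans ?_ (hY v hv))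
        unfold degreeIn
        refine Finset.card_le_card fun w hw => ?_
        obtain ⟨h1, h2⟩ := Finset.mem_filter.1 hw
        exact Finset.mem_filter.2 ⟨(Finset.mem_filter.1 h1).1, h2.1⟩)
      (2 * (d + 1))
    rw [Finset.empty_union, Finset.filter_true_of_mem hb] at key
    have hval : ∀ v ∈ Y, greedy (classGraph G ν (j + 1)) (fun _ => Finset.range (d + 1)) Y
        (fun u => schedule G Y ν d j u + (d + 1) * (ν u / 2 ^ j % 2)) (fun _ => none)
        (2 * (d + 1)) v = some (schedule G Y ν d (j + 1) v) := by
      intro v hv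
      obtain ⟨x, hx⟩ := Option.ne_none_iff_exists'.1 ((key.ne_none_iff v).2 hv)
      simp only [schedule, hx, Option.getD_some]
    refine ⟨fun v hv => ?_, fun u hu w hw huw h e => ?_⟩
    · exact Finset.mem_range.1 (key.mem_list v _ (hval v hv))
    · exact key.proper u w _ ⟨huw, h⟩ (hval u hu) (e ▸ hval w hw)

theorem mem_ruling_succ {Y A : Finset V} {ν : V → ℕ} {α j : ℕ} {q : V} :
    q ∈ ruling G Y ν α A (j + 1) ↔ q ∈ ruling G Y ν α A j ∧
      ∀ q' ∈ ruling G Y ν α A j, q' ∈ ball G Y α q →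
        ν q' / 2 ^ (j + 1) = ν q / 2 ^ (j + 1) → ¬ ν q' / 2 ^ j < ν q / 2 ^ j := by
  classical
  exact Finset.mem_filter

theorem ruling_subset {Y A : Finset V} {ν : V → ℕ} {α : ℕ} (j : ℕ) :
    ruling G Y ν α A j ⊆ A := by
  induction j with
  | zero => rfl
  | succ j ih => exact fun q hq => ih (mem_ruling_succ.1 hq).1

/-- If two close survivors of a merged class came from different halves, the one in the upper half
would have been removed. So they came from the same half, and induction applies. -/
theorem ruling_separated {Y A : Finset V} {ν : V → ℕ} {α : ℕ} (hν : Function.Injective ν)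
    (hA : A ⊆ Y) (j : ℕ) {q q' : V} (hq : q ∈ ruling G Y ν α A j) (hq' : q' ∈ ruling G Y ν α A j)
    (hcl : ν q / 2 ^ j = ν q' / 2 ^ j) (hball : q' ∈ ball G Y α q) : q = q' := by
  induction j with
  | zero =>
    simp only [pow_zero, Nat.div_one] at hcl
    exact hν hcl
  | succ j ih =>
    obtain ⟨h1, h2⟩ := mem_ruling_succ.1 hq
    obtain ⟨h1', h2'⟩ := mem_ruling_succ.1 hq'
    have hball' := mem_ball_symm (hA (ruling_subset _ hq)) hball
    have := h2 q' h1' hball hcl.symm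
    have := h2' q h1 hball' hcl
    exact ih h1 h1' (by omega)

/-- A vertex removed in one step is close to a vertex in the lower half of its class, and vertices
of the lower half survive this step. Thus each bit costs a distance of `α`. -/
theorem ruling_dominating {Y A : Finset V} {ν : V → ℕ} {α : ℕ} (j : ℕ) {a : V} (ha : a ∈ A) :
    ∃ q ∈ ruling G Y ν α A j, q ∈ ball G Y (α * j) a := by
  induction j with
  | zero => exact ⟨a, ha, self_mem_ball _ _⟩
  | succ j ih =>
    obtain ⟨q, hq, hqa⟩ := ih
    by_cases hq1 : q ∈ ruling G Y ν α A (j + 1)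
    · exact ⟨q, hq1, ball_mono (Nat.mul_le_mul_left _ (Nat.le_succ j)) a hqa⟩
    · rw [mem_ruling_succ] at hq1
      push Not at hq1
      obtain ⟨q', hq', hball, hcl, hlt⟩ := hq1 hq
      refine ⟨q', mem_ruling_succ.2 ⟨hq', fun q'' _ _ hcl' hlt' => ?_⟩,
        mem_ball_trans hqa hball⟩
      rw [pow_succ, ← Nat.div_div_eq_div_mul, ← Nat.div_div_eq_div_mul] at hcl hcl'
      omega

theorem Near.mono {Y Q : Finset V} {r s : ℕ} {v : V} (h : Near G Y Q r v) (hrs : r ≤ s) :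
    Near G Y Q s v :=
  let ⟨q, hq, hb⟩ := h
  ⟨q, hq, ball_mono hrs v hb⟩

/-- The radii that are too small form an initial segment, so counting them gives the distance;
truncation at `b` is harmless for a vertex within reach `b`. -/
theorem near_iff_layer_le {Y Q : Finset V} {b r : ℕ} {v : V} (hb : Near G Y Q b v) :
    Near G Y Q r v ↔ layer G Y Q b v ≤ r := by
  classical
  have hex : ∃ s, Near G Y Q s v := ⟨b, hb⟩
  have h1 : layer G Y Q b v = Nat.find hex := by
    unfold layer
    rw [← Finset.card_range (Nat.find hex)]
    congr 1
    ext s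
    simp only [Finset.mem_filter, Finset.mem_range, Nat.lt_find_iff]
    constructor
    · rintro ⟨-, h⟩ k hk hn
      exact h (hn.mono hk)
    · intro h
      refine ⟨?_, h s le_rfl⟩
      by_contra hsb
      exact h b (by omega) hb
  rw [h1, Nat.find_le_iff]
  exact ⟨fun h => ⟨r, le_rfl, h⟩, fun ⟨s, hs, h⟩ => h.mono hs⟩

theorem mem_centers {Y Q : Finset V} {R : ℕ} {v q : V} :
    q ∈ centers G Y R Q v ↔ q ∈ Q ∧ v ∈ Y ∧ q ∈ ball G Y R v := by
  classical
  exact Finset.mem_filter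

section Phase

variable {ν : V → ℕ} {d R m : ℕ} {U : Finset V}

theorem roots_subset : roots C G ν d R m U ⊆ happy C G d R U := ruling_subset m

theorem mem_removed {v : V} : v ∈ removed C G ν d R m U ↔ v ∈ rich G d U ∧
    Near G (rich G d U) (roots C G ν d R m U) ((2 * R + 1) * m) v := by
  classical
  exact Finset.mem_filter

theorem mem_outer {v : V} : v ∈ outer C G ν d R m U ↔ v ∈ removed C G ν d R m U ∧
    ¬ Near G (rich G d U) (roots C G ν d R m U) R v := by
  classical
  exact Finset.mem_filter

theorem happy_subset_removed : happy C G d R U ⊆ removed C G ν d R m U := fun _ ha =>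
  mem_removed.2 ⟨happy_subset ha, ruling_dominating m ha⟩

theorem removed_subset : removed C G ν d R m U ⊆ U := fun _ h => rich_subset (mem_removed.1 h).1

theorem peel_subset : peel C G ν d R m U ⊆ U := Finset.sdiff_subset

/-- An outer vertex of layer `k + 1` has a rich neighbor of layer at most `k`. That neighbor is
removed too, and it is either outer with a later time slot or inside the ball of a root. So at most
`d - 1` neighbors in `U` are colored before the vertex itself. -/
theorem outer_spec {c : V → Option C} (hν : Function.Injective ν) (hνm : ∀ v, ν v < 2 ^ m)
    (hL : ∀ v ∈ U, d ≤ (L v).card) (hc : IsPartialColoring G L (peel C G ν d R m U) c) :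
    IsPartialColoring G L (peel C G ν d R m U ∪ outer C G ν d R m U)
      (greedy G L (outer C G ν d R m U) (colorTime C G ν d R m U) c
        (((2 * R + 1) * m + 1) * (d + 1))) := by
  have hrichY : ∀ v ∈ rich G d U, degreeIn G (rich G d U) v ≤ d := fun v hv =>
    (degreeIn_mono rich_subset v).trans (degreeIn_le_of_mem_rich hv)
  obtain ⟨hs1, hs2⟩ := schedule_spec (G := G) hν hrichY m
  have hor : ∀ v ∈ outer C G ν d R m U, v ∈ rich G d U := fun v hv =>
    (mem_removed.1 (mem_outer.1 hv).1).1
  have hlay : ∀ v ∈ outer C G ν d R m U, layer G (rich G d U) (roots C G ν d R m U)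
      ((2 * R + 1) * m) v ≤ (2 * R + 1) * m := by
    intro v hv
    have hn := (mem_removed.1 (mem_outer.1 hv).1).2
    exact (near_iff_layer_le hn).1 hn
  have h := greedy_spec (D := outer C G ν d R m U) (key := colorTime C G ν d R m U) hc
    (by
      intro u hu w hw huw e
      have h1 := hs1 u (hor u hu)
      have h2 := hs1 w (hor w hw)
      have h3 := congrArg (· % (d + 1)) e
      simp only [colorTime, Nat.mul_add_mod', Nat.mod_eq_of_lt h1, Nat.mod_eq_of_lt h2] at h3
      exact hs2 u (hor u hu) w (hor w hw) huw
        (by rw [Nat.div_eq_of_lt (hνm u), Nat.div_eq_of_lt (hνm w)]) h3)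
    (by
      intro v hv
      have hvr := hor v hv
      have hnv := (mem_removed.1 (mem_outer.1 hv).1).2
      have hnR := (mem_outer.1 hv).2
      rw [near_iff_layer_le hnv] at hnR
      obtain ⟨k, hk⟩ : ∃ k, layer G (rich G d U) (roots C G ν d R m U) ((2 * R + 1) * m) v =
        k + 1 := ⟨_, (Nat.succ_pred_eq_of_pos (by omega)).symm⟩
      obtain ⟨q, hq, hqv⟩ := (near_iff_layer_le hnv).2 hk.le
      have hnk : ¬ Near G (rich G d U) (roots C G ν d R m U) k v := by
        rw [near_iff_layer_le hnv]; omega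
      have hqr : q ∈ rich G d U := happy_subset (roots_subset hq)
      have hvq := mem_ball_symm hvr hqv
      obtain ⟨w, hw, hwv⟩ : ∃ w ∈ ball G (rich G d U) k q, G.Adj w v := by
        rcases mem_ball_succ.1 hvq with h | h
        · exact (hnk ⟨q, hq, mem_ball_symm hqr h⟩).elim
        · exact h.2
      have hwr : w ∈ rich G d U := ball_subset hqr k hw
      have hwk : Near G (rich G d U) (roots C G ν d R m U) k w := ⟨q, hq, mem_ball_symm hqr hw⟩
      have hlv := hlay v hv
      have hwn : Near G (rich G d U) (roots C G ν d R m U) ((2 * R + 1) * m) w :=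
        hwk.mono (by omega)
      have hwl := (near_iff_layer_le hwn).1 hwk
      have hsub : peel C G ν d R m U ∪ (outer C G ν d R m U).filter (fun u =>
          colorTime C G ν d R m U u < colorTime C G ν d R m U v) ⊆ U.erase w := by
        intro u hu
        rw [Finset.mem_union, Finset.mem_filter] at hu
        rcases hu with hu | ⟨hu, hlt⟩
        · refine Finset.mem_erase.2 ⟨?_, peel_subset hu⟩
          rintro rfl
          exact (Finset.mem_sdiff.1 hu).2 (mem_removed.2 ⟨hwr, hwn⟩)
        · refine Finset.mem_erase.2 ⟨?_, rich_subset (hor u hu)⟩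
          rintro rfl
          have h1 := hs1 v hvr
          unfold colorTime at hlt
          have h2 : (2 * R + 1) * m - layer G (rich G d U) (roots C G ν d R m U)
              ((2 * R + 1) * m) v + 1 ≤ (2 * R + 1) * m - layer G (rich G d U)
              (roots C G ν d R m U) ((2 * R + 1) * m) u := by omega
          have h3 := Nat.mul_le_mul_right (d + 1) h2
          rw [Nat.add_mul, one_mul] at h3
          omega
      have h1 := degreeIn_mono (G := G) hsub v
      have h2 := degreeIn_erase (rich_subset hwr) hwv.symm
      have h3 := degreeIn_le_of_mem_rich hvr
      have h4 := hL v (rich_subset hvr)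
      omega)
    (((2 * R + 1) * m + 1) * (d + 1))
  rwa [Finset.filter_true_of_mem] at h
  intro v hv
  have h1 := hs1 v (hor v hv)
  have h2 := Nat.mul_le_mul_right (d + 1) (Nat.sub_le ((2 * R + 1) * m)
    (layer G (rich G d U) (roots C G ν d R m U) ((2 * R + 1) * m) v))
  unfold colorTime
  rw [Nat.add_mul ((2 * R + 1) * m), one_mul]
  omega

/-- Separation of the roots lets their balls be completed independently. As nothing inside a ball is
colored before, each of its vertices has lost at most one color per neighbor in `U` outside of the
ball, which flexibility allows. -/
theorem extend_spec {c : V → Option C} (hν : Function.Injective ν) (hνm : ∀ v, ν v < 2 ^ m)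
    (hm : 1 ≤ m) (hL : ∀ v ∈ U, d ≤ (L v).card)
    (hc : IsPartialColoring G L (peel C G ν d R m U) c) :
    IsPartialColoring G L U (extend G ν d R m L U c) := by
  have h := outer_spec hν hνm hL hc
  unfold extend
  set c₁ := greedy G L (outer C G ν d R m U) (colorTime C G ν d R m U) c
    (((2 * R + 1) * m + 1) * (d + 1)) with hc₁
  set Y := rich G d U with hY
  set Q := roots C G ν d R m U with hQ
  have hQY : Q ⊆ Y := roots_subset.trans happy_subset
  have hsep : ∀ q ∈ Q, ∀ q' ∈ Q, q' ∈ ball G Y (2 * R + 1) q → q = q' := fun q hq q' hq' hb =>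
    ruling_separated hν happy_subset m hq hq'
      (by rw [Nat.div_eq_of_lt (hνm q), Nat.div_eq_of_lt (hνm q')]) hb
  have hRm : R ≤ (2 * R + 1) * m := by nlinarith
  have hcenter : ∀ q ∈ Q, ∀ u ∈ ball G Y R q, finish G L Y R Q c₁ u =
      ballColoring G L Y R c₁ q u := by
    intro q hq u hu
    have hmem : q ∈ centers G Y R Q u :=
      mem_centers.2 ⟨hq, ball_subset (hQY hq) R hu, mem_ball_symm (hQY hq) hu⟩
    unfold finish
    obtain ⟨q', hq'⟩ := Option.ne_none_iff_exists'.1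
      (mt pick_eq_none.1 (Finset.ne_empty_of_mem hmem))
    obtain ⟨h1, -, h3⟩ := mem_centers.1 (mem_of_pick_eq hq')
    have : q = q' := hsep q hq q' h1 (ball_mono (by omega) q (mem_ball_trans hu h3))
    rw [hq', ← this, Option.elim_some]
  have hfar : ∀ u, (∀ q ∈ Q, u ∉ ball G Y R q) → finish G L Y R Q c₁ u = c₁ u := by
    intro u hu
    have : centers G Y R Q u = ∅ := by
      refine Finset.eq_empty_of_forall_notMem fun q hq => ?_
      obtain ⟨h1, h2, h3⟩ := mem_centers.1 hq
      exact hu q h1 (mem_ball_symm h2 h3)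
    unfold finish
    rw [pick_eq_none.2 this, Option.elim_none]
  have hinner : ∀ q ∈ Q, ∀ u ∈ ball G Y R q, u ∉ peel C G ν d R m U ∪ outer C G ν d R m U := by
    intro q hq u hu hmem
    have hn : Near G Y Q R u := ⟨q, hq, mem_ball_symm (hQY hq) hu⟩
    rcases Finset.mem_union.1 hmem with h1 | h1
    · exact (Finset.mem_sdiff.1 h1).2 (mem_removed.2 ⟨ball_subset (hQY hq) R hu, hn.mono hRm⟩)
    · exact (mem_outer.1 h1).2 hn
  have hball : ∀ q ∈ Q, ∃ f : V → C, (∀ u ∈ ball G Y R q, finish G L Y R Q c₁ u = some (f u) ∧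
      f u ∈ avail G L c₁ u) ∧
      ∀ u ∈ ball G Y R q, ∀ w ∈ ball G Y R q, G.Adj u w → f u ≠ f w := by
    intro q hq
    have hBU : ball G Y R q ⊆ U := (ball_subset (hQY hq) R).trans rich_subset
    have hsol : ListColorableOn (restrict G (ball G Y R q)) (ball G Y R q)
        (fun u => if u ∈ ball G Y R q then avail G L c₁ u else ∅) := by
      have hflex : Flexible C G d U (ball G Y R q) := (mem_happy.1 (roots_subset hq)).2
      obtain ⟨f, h1, h2⟩ := hflex (fun u => if u ∈ ball G Y R q then avail G L c₁ u else ∅) (by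
        intro u hu
        have h1 := card_le_card_avail_add (G := G) (L := L) (c := c₁) (v := u)
          (W := U \ ball G Y R q) (by
          intro w huw hw
          have hwm := (h.ne_none_iff w).1 hw
          refine Finset.mem_sdiff.2 ⟨?_, fun hwB => hinner q hq w hwB hwm⟩
          rcases Finset.mem_union.1 hwm with h1 | h1
          · exact peel_subset h1
          · exact removed_subset (mem_outer.1 h1).1)
        have h2 := degreeIn_add_sdiff (G := G) hBU u
        have h3 := hL u (hBU hu)
        simp only [if_pos hu]
        omega)
      exact ⟨f, h1, fun u hu w hw huw => h2 u hu w hw huw.1⟩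
    refine ⟨hsol.choose, fun u hu => ⟨?_, ?_⟩, fun u hu w hw huw =>
      hsol.choose_spec.2 u hu w hw ⟨huw, hu, hw⟩⟩
    · rw [hcenter q hq u hu]
      unfold ballColoring solve
      rw [dif_pos hsol]
    · have := hsol.choose_spec.1 u hu
      simpa only [if_pos hu] using this
  refine ⟨fun v => ?_, fun v x hx => ?_, fun u w x huw hu hw => ?_⟩
  · by_cases hv : ∃ q ∈ Q, v ∈ ball G Y R q
    · obtain ⟨q, hq, hvq⟩ := hv
      obtain ⟨f, hf, -⟩ := hball q hq
      rw [(hf v hvq).1]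
      simpa using rich_subset (ball_subset (hQY hq) R hvq)
    · push Not at hv
      rw [hfar v hv, h.ne_none_iff v, Finset.mem_union]
      constructor
      · rintro (h1 | h1)
        · exact peel_subset h1
        · exact removed_subset (mem_outer.1 h1).1
      · intro hvU
        by_cases hvT : v ∈ removed C G ν d R m U
        · refine Or.inr (mem_outer.2 ⟨hvT, ?_⟩)
          rintro ⟨q, hq, hqv⟩
          exact hv q hq (mem_ball_symm (mem_removed.1 hvT).1 hqv)
        · exact Or.inl (Finset.mem_sdiff.2 ⟨hvU, hvT⟩)
  · by_cases hv : ∃ q ∈ Q, v ∈ ball G Y R q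
    · obtain ⟨q, hq, hvq⟩ := hv
      obtain ⟨f, hf, -⟩ := hball q hq
      obtain ⟨h1, h2⟩ := hf v hvq
      rw [h1] at hx
      rw [← Option.some.inj hx]
      exact (mem_avail.1 h2).1
    · push Not at hv
      rw [hfar v hv] at hx
      exact h.mem_list v x hx
  · by_cases hu' : ∃ q ∈ Q, u ∈ ball G Y R q
    · obtain ⟨q, hq, huq⟩ := hu'
      obtain ⟨f, hf, hfp⟩ := hball q hq
      obtain ⟨h1, h2⟩ := hf u huq
      rw [h1] at hu
      by_cases hw' : ∃ q' ∈ Q, w ∈ ball G Y R q'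
      · obtain ⟨q', hq', hwq'⟩ := hw'
        have hwY := ball_subset (hQY hq') R hwq'
        have hqq : q = q' := hsep q hq q' hq' (by
          have := mem_ball_trans (mem_ball_trans huq (mem_ball_one hwY huw))
            (mem_ball_symm (hQY hq') hwq')
          exact ball_mono (by omega) q this)
        subst hqq
        rw [(hf w hwq').1, ← hu] at hw
        exact hfp u huq w hwq' huw (Option.some.inj hw).symm
      · push Not at hw'
        rw [hfar w hw', ← hu] at hw
        exact (mem_avail.1 h2).2 w huw hw
    · push Not at hu'
      rw [hfar u hu'] at hu
      by_cases hw' : ∃ q ∈ Q, w ∈ ball G Y R q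
      · obtain ⟨q, hq, hwq⟩ := hw'
        obtain ⟨f, hf, -⟩ := hball q hq
        obtain ⟨h1, h2⟩ := hf w hwq
        rw [h1, ← hu] at hw
        exact (mem_avail.1 h2).2 u huw.symm hw.symm
      · push Not at hw'
        rw [hfar w hw'] at hw
        exact h.proper u w x huw hu hw

theorem coloring_spec (hν : Function.Injective ν) (hνm : ∀ v, ν v < 2 ^ m) (hm : 1 ≤ m) (k : ℕ)
    (hL : ∀ v ∈ U, d ≤ (L v).card) (hk : (peel C G ν d R m)^[k] U = ∅) :
    IsPartialColoring G L U (coloring G ν d R m L k U) := by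
  induction k generalizing U with
  | zero =>
    simp only [Function.iterate_zero, id_eq] at hk
    subst hk
    exact isPartialColoring_none
  | succ k ih =>
    exact extend_spec hν hνm hm hL (ih (fun v hv => hL v (peel_subset hv)) hk)

end Phase

end Correctness

/-! ### Locality of the procedure -/

/-- The graphs `G` and `G'` look the same around the vertices of `S r` up to distance `r`. -/
structure Zone {V : Type*} (G G' : SimpleGraph V) (S : ℕ → Set V) : Prop where
  antitone : Antitone S
  adj_iff : ∀ {r v}, v ∈ S (r + 1) → ∀ w, G.Adj v w ↔ G'.Adj v w
  step : ∀ {r v w}, v ∈ S (r + 1) → G.Adj v w → w ∈ S r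

section Locality

variable {V : Type*} [DecidableEq V] {C : Type*} {G G' : SimpleGraph V} {S : ℕ → Set V}

/-- Data that agree on `S k` agree on level `0` of the shifted zone and can serve as input of the
next computation. This is how the radii of successive steps add up. -/
theorem Zone.shift (h : Zone G G' S) (k : ℕ) : Zone G G' fun r => S (r + k) where
  antitone := fun _ _ hab => h.antitone (Nat.add_le_add_right hab k)
  adj_iff := fun {r v} hv => h.adj_iff (r := r + k) (by rwa [Nat.add_right_comm])
  step := fun {r v w} hv hvw => h.step (r := r + k) (by rwa [Nat.add_right_comm]) hvw

theorem Zone.classGraph (h : Zone G G' S) (ν : V → ℕ) (k : ℕ) :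
    Zone (classGraph G ν k) (LocalColoring.classGraph G' ν k) S where
  antitone := h.antitone
  adj_iff := fun hv w => and_congr_left fun _ => h.adj_iff hv w
  step := fun hv hvw => h.step hv hvw.1

theorem Zone.mem_of_mem_ball (h : Zone G G' S) {Y : Finset V} {r s : ℕ} {v u : V}
    (hv : v ∈ S (r + s)) (hu : u ∈ ball G Y r v) : u ∈ S s := by
  induction r generalizing s u with
  | zero =>
    simp only [ball, Finset.mem_singleton] at hu
    rw [hu]
    simpa using hv
  | succ r ih =>
    rcases mem_ball_succ.1 hu with h1 | ⟨-, w, hw, hwu⟩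
    · exact ih (h.antitone (by omega) hv) h1
    · exact h.step (ih (s := s + 1) (h.antitone (by omega) hv) hw) hwu

theorem Zone.ball_eq (h : Zone G G' S) {Y Y' : Finset V} (hY : ∀ v ∈ S 0, v ∈ Y ↔ v ∈ Y') {r : ℕ}
    {v : V} (hv : v ∈ S r) : ball G Y r v = ball G' Y' r v := by
  induction r with
  | zero => rfl
  | succ r ih =>
    have e := ih (h.antitone (Nat.le_succ r) hv)
    ext u
    rw [mem_ball_succ, mem_ball_succ, ← e]
    refine or_congr_right ?_
    have key : ∀ w ∈ ball G Y r v, (G.Adj w u ↔ G'.Adj w u) ∧ (G.Adj w u → u ∈ S 0) :=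
      fun w hw => ⟨h.adj_iff (h.mem_of_mem_ball (s := 0 + 1) (h.antitone (by omega) hv) hw) u,
        h.step (h.mem_of_mem_ball (s := 0 + 1) (h.antitone (by omega) hv) hw)⟩
    constructor
    · rintro ⟨hu, w, hw, hwu⟩
      exact ⟨(hY u ((key w hw).2 hwu)).1 hu, w, hw, (key w hw).1.1 hwu⟩
    · rintro ⟨hu, w, hw, hwu⟩
      have := (key w hw).1.2 hwu
      exact ⟨(hY u ((key w hw).2 this)).2 hu, w, hw, this⟩

theorem Zone.degreeIn_eq (h : Zone G G' S) {U U' : Finset V} (hU : ∀ v ∈ S 0, v ∈ U ↔ v ∈ U')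
    {v : V} (hv : v ∈ S 1) : degreeIn G U v = degreeIn G' U' v := by
  classical
  unfold degreeIn
  congr 1
  ext w
  simp only [Finset.mem_filter]
  rw [← h.adj_iff (r := 0) hv w]
  exact and_congr_left fun hvw => hU w (h.step (r := 0) hv hvw)

theorem Zone.mem_rich_iff (h : Zone G G' S) {U U' : Finset V} (hU : ∀ v ∈ S 0, v ∈ U ↔ v ∈ U')
    {d : ℕ} {v : V} (hv : v ∈ S 1) : v ∈ rich G d U ↔ v ∈ rich G' d U' := by
  unfold rich
  rw [Finset.mem_filter, Finset.mem_filter, h.degreeIn_eq hU hv,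
    hU v (h.antitone (Nat.zero_le 1) hv)]

theorem listColorableOn_congr {B : Finset V} {L : V → Finset C}
    (h : ∀ u ∈ B, ∀ w, G.Adj u w ↔ G'.Adj u w) :
    ListColorableOn G B L ↔ ListColorableOn G' B L :=
  exists_congr fun _ => and_congr_right fun _ => forall₂_congr fun u hu => forall₂_congr
    fun w _ => by rw [h u hu w]

theorem flexible_congr {U U' B : Finset V} {d : ℕ} (h : ∀ u ∈ B, ∀ w, G.Adj u w ↔ G'.Adj u w)
    (hU : ∀ u ∈ B, degreeIn G U u = degreeIn G' U' u) :
    Flexible C G d U B ↔ Flexible C G' d U' B := by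
  classical
  refine forall_congr' fun L => ?_
  rw [listColorableOn_congr h]
  have : ∀ u ∈ B, degreeIn G B u = degreeIn G' B u := by
    intro u hu
    unfold degreeIn
    exact congrArg _ (Finset.filter_congr fun w _ => h u hu w)
  refine imp_congr_left (forall₂_congr fun u hu => ?_)
  rw [hU u hu, this u hu]

theorem Zone.mem_happy_iff (h : Zone G G' S) {U U' : Finset V} (hU : ∀ v ∈ S 0, v ∈ U ↔ v ∈ U')
    {d R : ℕ} {v : V} (hv : v ∈ S (R + 2)) : v ∈ happy C G d R U ↔ v ∈ happy C G' d R U' := by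
  have hY : ∀ v ∈ S (0 + 1), v ∈ rich G d U ↔ v ∈ rich G' d U' := fun v hv => h.mem_rich_iff hU hv
  have hball := (h.shift 1).ball_eq hY (r := R) (v := v) (h.antitone (by omega) hv)
  have hmem : ∀ u ∈ ball G (rich G d U) R v, u ∈ S 1 := fun u hu =>
    h.mem_of_mem_ball (h.antitone (by omega) hv) hu
  rw [mem_happy, mem_happy, hY v (h.antitone (by omega) hv), ← hball]
  exact and_congr_right fun _ => flexible_congr (fun u hu => h.adj_iff (r := 0) (hmem u hu))
    (fun u hu => h.degreeIn_eq hU (hmem u hu))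

theorem Zone.mem_ruling_iff (h : Zone G G' S) {Y Y' A A' : Finset V} {ν : V → ℕ} {α : ℕ}
    (hY : ∀ v ∈ S 0, v ∈ Y ↔ v ∈ Y') (hA : ∀ v ∈ S 0, v ∈ A ↔ v ∈ A') (j : ℕ) {v : V}
    (hv : v ∈ S (α * j)) : v ∈ ruling G Y ν α A j ↔ v ∈ ruling G' Y' ν α A' j := by
  induction j generalizing v with
  | zero => exact hA v (by simpa using hv)
  | succ j ih =>
    rw [Nat.mul_succ, add_comm] at hv
    rw [mem_ruling_succ, mem_ruling_succ, ih (h.antitone (by omega) hv),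
      ← h.ball_eq hY (h.antitone (by omega) hv)]
    refine and_congr_right fun _ => ⟨fun hq q' hq' hb => ?_, fun hq q' hq' hb => ?_⟩
    · exact hq q' ((ih (h.mem_of_mem_ball hv hb)).2 hq') hb
    · exact hq q' ((ih (h.mem_of_mem_ball hv hb)).1 hq') hb

theorem Zone.near_iff (h : Zone G G' S) {Y Y' Q Q' : Finset V} (hY : ∀ v ∈ S 0, v ∈ Y ↔ v ∈ Y')
    (hQ : ∀ v ∈ S 0, v ∈ Q ↔ v ∈ Q') {r : ℕ} {v : V} (hv : v ∈ S r) :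
    Near G Y Q r v ↔ Near G' Y' Q' r v := by
  unfold Near
  rw [← h.ball_eq hY hv]
  exact exists_congr fun q => and_congr_left fun hq =>
    hQ q (h.mem_of_mem_ball (s := 0) (by simpa using hv) hq)

theorem Zone.layer_eq (h : Zone G G' S) {Y Y' Q Q' : Finset V} (hY : ∀ v ∈ S 0, v ∈ Y ↔ v ∈ Y')
    (hQ : ∀ v ∈ S 0, v ∈ Q ↔ v ∈ Q') {b : ℕ} {v : V} (hv : v ∈ S b) :
    layer G Y Q b v = layer G' Y' Q' b v := by
  classical
  unfold layer
  congr 1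
  refine Finset.filter_congr fun r hr => ?_
  rw [h.near_iff hY hQ (h.antitone (Finset.mem_range.1 hr).le hv)]

theorem Zone.avail_eq (h : Zone G G' S) {L L' : V → Finset C} {c c' : V → Option C}
    (hL : ∀ v ∈ S 0, L v = L' v) (hc : ∀ v ∈ S 0, c v = c' v) {v : V} (hv : v ∈ S 1) :
    avail G L c v = avail G' L' c' v := by
  ext x
  rw [mem_avail, mem_avail, hL v (h.antitone (Nat.zero_le 1) hv)]
  refine and_congr_right fun _ => forall_congr' fun w => ?_
  rw [← h.adj_iff (r := 0) hv w]
  exact imp_congr_right fun hvw => by rw [hc w (h.step (r := 0) hv hvw)]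

/-- One level per time step, since a vertex inspects only the current colors of its neighbors. -/
theorem Zone.greedy_eq (h : Zone G G' S) {L L' : V → Finset C} {D D' : Finset V}
    {key key' : V → ℕ} {c c' : V → Option C} (hL : ∀ v ∈ S 0, L v = L' v)
    (hD : ∀ v ∈ S 0, v ∈ D ↔ v ∈ D') (hkey : ∀ v ∈ S 0, key v = key' v)
    (hc : ∀ v ∈ S 0, c v = c' v) (t : ℕ) {v : V} (hv : v ∈ S t) :
    greedy G L D key c t v = greedy G' L' D' key' c' t v := by
  induction t generalizing v with
  | zero => exact hc v hv
  | succ t ih =>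
    have h0 := h.antitone (Nat.zero_le _) hv
    simp only [greedy]
    rw [(h.shift t).avail_eq (c := greedy G L D key c t) (c' := greedy G' L' D' key' c' t)
      (fun w hw => hL w (h.antitone (Nat.zero_le _) hw))
      (fun w hw => ih (by simpa using hw)) (by simpa [add_comm] using hv),
      ih (h.antitone (Nat.le_succ t) hv)]
    simp only [hD v h0, hkey v h0]

theorem Zone.schedule_eq (h : Zone G G' S) {Y Y' : Finset V} {ν : V → ℕ} {d : ℕ}
    (hY : ∀ v ∈ S 0, v ∈ Y ↔ v ∈ Y') (j : ℕ) {v : V} (hv : v ∈ S (2 * (d + 1) * j)) :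
    schedule G Y ν d j v = schedule G' Y' ν d j v := by
  induction j generalizing v with
  | zero => rfl
  | succ j ih =>
    simp only [schedule]
    congr 1
    refine ((h.shift (2 * (d + 1) * j)).classGraph ν (j + 1)).greedy_eq (fun _ _ => rfl)
      (fun w hw => hY w (h.antitone (Nat.zero_le _) hw))
      (fun w hw => by rw [ih (by simpa using hw)]) (fun _ _ => rfl) _ ?_
    rwa [Nat.mul_succ, add_comm] at hv

theorem Zone.ballColoring_eq (h : Zone G G' S) {L L' : V → Finset C} {Y Y' : Finset V} {R : ℕ}
    {c c' : V → Option C} (hL : ∀ v ∈ S 0, L v = L' v) (hY : ∀ v ∈ S 0, v ∈ Y ↔ v ∈ Y')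
    (hc : ∀ v ∈ S 0, c v = c' v) {q : V} (hq : q ∈ S (R + 1)) :
    ballColoring G L Y R c q = ballColoring G' L' Y' R c' q := by
  have hB := h.ball_eq hY (h.antitone (Nat.le_succ R) hq)
  have hmem : ∀ u ∈ ball G Y R q, u ∈ S 1 := fun u hu => h.mem_of_mem_ball hq hu
  unfold ballColoring
  have h1 : restrict G (ball G Y R q) = restrict G' (ball G' Y' R q) := by
    rw [← hB]
    ext u w
    exact and_congr_left fun hu => h.adj_iff (r := 0) (hmem u hu.1) w
  rw [h1, ← hB]
  congr 1
  funext u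
  split_ifs with hu
  · exact h.avail_eq hL hc (hmem u hu)
  · rfl

theorem Zone.finish_eq (h : Zone G G' S) {L L' : V → Finset C} {Y Y' Q Q' : Finset V} {R : ℕ}
    {c c' : V → Option C} (hL : ∀ v ∈ S 0, L v = L' v) (hY : ∀ v ∈ S 0, v ∈ Y ↔ v ∈ Y')
    (hQ : ∀ v ∈ S 0, v ∈ Q ↔ v ∈ Q') (hc : ∀ v ∈ S 0, c v = c' v) {v : V}
    (hv : v ∈ S (R + (R + 1))) : finish G L Y R Q c v = finish G' L' Y' R Q' c' v := by
  have h0 := h.antitone (Nat.zero_le _) hv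
  have hmem : ∀ q ∈ ball G Y R v, q ∈ S (R + 1) := fun q hq => h.mem_of_mem_ball hv hq
  have hcen : centers G Y R Q v = centers G' Y' R Q' v := by
    ext q
    rw [mem_centers, mem_centers, hY v h0, ← h.ball_eq hY (h.antitone (by omega) hv)]
    exact and_congr_left fun hq => hQ q (h.antitone (Nat.zero_le _) (hmem q hq.2))
  unfold finish
  rw [hcen, hc v h0]
  rcases hp : pick (centers G' Y' R Q' v) with _ | q
  · rfl
  · have hq := mem_of_pick_eq hp
    rw [← hcen, mem_centers] at hq
    rw [Option.elim_some, Option.elim_some, h.ballColoring_eq hL hY hc (hmem q hq.2.2)]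

section Phase

variable {ν : V → ℕ} {d R m : ℕ} {U U' : Finset V}

theorem Zone.mem_roots_iff (h : Zone G G' S) (hU : ∀ v ∈ S 0, v ∈ U ↔ v ∈ U') {v : V}
    (hv : v ∈ S ((2 * R + 1) * m + (R + 2))) :
    v ∈ roots C G ν d R m U ↔ v ∈ roots C G' ν d R m U' :=
  (h.shift (R + 2)).mem_ruling_iff (fun _ hw => h.mem_rich_iff hU (h.antitone (by omega) hw))
    (fun w hw => h.mem_happy_iff hU (by simpa using hw)) m hv

theorem Zone.near_roots_iff (h : Zone G G' S) (hU : ∀ v ∈ S 0, v ∈ U ↔ v ∈ U') {r : ℕ} {v : V}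
    (hv : v ∈ S (r + ((2 * R + 1) * m + (R + 2)))) :
    Near G (rich G d U) (roots C G ν d R m U) r v ↔
      Near G' (rich G' d U') (roots C G' ν d R m U') r v :=
  (h.shift ((2 * R + 1) * m + (R + 2))).near_iff
    (fun _ hw => h.mem_rich_iff hU (h.antitone (by omega) hw))
    (fun w hw => h.mem_roots_iff hU (by simpa using hw)) hv

theorem Zone.mem_removed_iff (h : Zone G G' S) (hU : ∀ v ∈ S 0, v ∈ U ↔ v ∈ U') {v : V}
    (hv : v ∈ S ((2 * R + 1) * m + ((2 * R + 1) * m + (R + 2)))) :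
    v ∈ removed C G ν d R m U ↔ v ∈ removed C G' ν d R m U' := by
  rw [mem_removed, mem_removed, h.near_roots_iff hU hv,
    h.mem_rich_iff hU (h.antitone (by omega) hv)]

theorem Zone.mem_peel_iff (h : Zone G G' S) (hU : ∀ v ∈ S 0, v ∈ U ↔ v ∈ U') {v : V}
    (hv : v ∈ S ((2 * R + 1) * m + ((2 * R + 1) * m + (R + 2)))) :
    v ∈ peel C G ν d R m U ↔ v ∈ peel C G' ν d R m U' := by
  unfold peel
  rw [Finset.mem_sdiff, Finset.mem_sdiff, h.mem_removed_iff hU hv,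
    hU v (h.antitone (Nat.zero_le _) hv)]

/-- The number of rounds in which a vertex learns when it is colored in the current phase. -/
def scheduleRadius (d R m : ℕ) : ℕ :=
  2 * (d + 1) * m + ((2 * R + 1) * m + ((2 * R + 1) * m + (R + 2)) + R)

/-- The number of rounds of one phase. -/
def phaseRadius (d R m : ℕ) : ℕ :=
  R + (R + 1) + (((2 * R + 1) * m + 1) * (d + 1) + scheduleRadius d R m)

theorem Zone.extend_eq (h : Zone G G' S) {L L' : V → Finset C} {c c' : V → Option C}
    (hL : ∀ v ∈ S 0, L v = L' v) (hU : ∀ v ∈ S 0, v ∈ U ↔ v ∈ U') (hc : ∀ v ∈ S 0, c v = c' v)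
    {v : V} (hv : v ∈ S (phaseRadius d R m)) :
    extend G ν d R m L U c v = extend G' ν d R m L' U' c' v := by
  unfold extend
  refine (h.shift (((2 * R + 1) * m + 1) * (d + 1) + scheduleRadius d R m)).finish_eq
    (fun w hw => hL w (h.antitone (Nat.zero_le _) hw))
    (fun w hw => h.mem_rich_iff hU (h.antitone (by unfold scheduleRadius; omega) hw))
    (fun w hw => h.mem_roots_iff hU (h.antitone (by unfold scheduleRadius; omega) hw))
    (fun w hw => ?_) hv
  refine (h.shift (scheduleRadius d R m)).greedy_eq
    (fun w hw => hL w (h.antitone (Nat.zero_le _) hw)) (fun w hw => ?_) (fun w hw => ?_)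
    (fun w hw => hc w (h.antitone (Nat.zero_le _) hw)) _ (by simpa using hw)
  · rw [mem_outer, mem_outer,
      h.mem_removed_iff hU (h.antitone (by unfold scheduleRadius; omega) hw),
      h.near_roots_iff hU (h.antitone (by unfold scheduleRadius; omega) hw)]
  · unfold colorTime
    have h1 := (h.shift 1).schedule_eq (ν := ν) (d := d)
      (fun w hw => h.mem_rich_iff hU (d := d) (by simpa using hw)) m
      (v := w) (h.antitone (by unfold scheduleRadius; omega) hw)
    have h2 := (h.shift ((2 * R + 1) * m + (R + 2))).layer_eq
      (fun w hw => h.mem_rich_iff hU (d := d) (h.antitone (by omega) hw))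
      (fun w hw => h.mem_roots_iff hU (C := C) (ν := ν) (d := d) (R := R) (m := m)
        (by simpa using hw)) (b := (2 * R + 1) * m) (v := w)
      (h.antitone (by unfold scheduleRadius; omega) hw)
    rw [h1, h2]

/-- No assumption that the phases exhaust `U` is needed. Hence this also applies in the second graph
of a zone, where the peeling may not stop. -/
theorem coloring_eq_none {L : V → Finset C} {k : ℕ} {v : V} (hv : v ∉ U) :
    coloring G ν d R m L k U v = none := by
  induction k generalizing U with
  | zero => rfl
  | succ k ih =>
    have hY : v ∉ rich G d U := fun h => hv (rich_subset h)
    have h1 : centers G (rich G d U) R (roots C G ν d R m U) v = ∅ :=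
      Finset.eq_empty_of_forall_notMem fun q hq => hY (mem_centers.1 hq).2.1
    have h2 : v ∉ outer C G ν d R m U := fun h => hY (mem_removed.1 (mem_outer.1 h).1).1
    have h3 : ∀ t, greedy G L (outer C G ν d R m U) (colorTime C G ν d R m U)
        (coloring G ν d R m L k (peel C G ν d R m U)) t v = none := by
      intro t
      induction t with
      | zero => exact ih fun h => hv (peel_subset h)
      | succ t iht => simp only [greedy, h2, false_and, if_false, iht]
    simp only [coloring, extend, finish, pick_eq_none.2 h1, Option.elim_none, h3]

/-- If `k` phases exhaust `U` in `G`, then the coloring around a vertex is determined by what it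
sees up to the distance covered by `k` phases. -/
theorem Zone.coloring_eq (h : Zone G G' S) {L L' : V → Finset C} (hL : ∀ v ∈ S 0, L v = L' v)
    (hU : ∀ v ∈ S 0, v ∈ U ↔ v ∈ U') {k : ℕ} (hk : (peel C G ν d R m)^[k] U = ∅) (M : ℕ) {v : V}
    (hv : v ∈ S (k * (2 * phaseRadius d R m))) :
    coloring G ν d R m L M U v = coloring G' ν d R m L' M U' v := by
  induction k generalizing U U' S M v with
  | zero =>
    simp only [Function.iterate_zero, id_eq] at hk
    have hvU : v ∉ U := by simp [hk]
    have hvU' : v ∉ U' := fun hv' => hvU ((hU v (by simpa using hv)).2 hv')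
    rw [coloring_eq_none hvU, coloring_eq_none hvU']
  | succ k ih =>
    rcases M with _ | M
    · rfl
    have hpr : (2 * R + 1) * m + ((2 * R + 1) * m + (R + 2)) ≤ phaseRadius d R m := by
      unfold phaseRadius scheduleRadius; omega
    simp only [coloring]
    -- Of the two copies of `phaseRadius` for this phase, one pays for the extension and the other
    -- for knowing which vertices are peeled.
    refine (h.shift (k * (2 * phaseRadius d R m) + phaseRadius d R m)).extend_eq
      (fun w hw => hL w (h.antitone (Nat.zero_le _) hw))
      (fun w hw => hU w (h.antitone (Nat.zero_le _) hw)) (fun w hw => ?_)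
      (h.antitone (le_of_eq (by ring)) hv)
    refine ih (h.shift (phaseRadius d R m)) (fun w hw => hL w (h.antitone (Nat.zero_le _) hw))
      (fun w hw => h.mem_peel_iff hU (h.antitone (by omega) hw)) hk M (by simpa using hw)

end Phase

end Locality

/-! ### The number of phases -/

section PhaseCount

/-- Bernoulli's inequality `(1 + 1 / b) ^ k ≥ 1 + k / b`, without denominators, for `k = b + 1`. It
says that removing an `a`-th part `a` times at least halves a set. -/
theorem two_mul_pow_le (b : ℕ) : 2 * b ^ (b + 1) ≤ (b + 1) ^ (b + 1) := by
  rcases Nat.eq_zero_or_pos b with rfl | hb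
  · simp
  have key : ∀ k, b ^ k * (b + k) ≤ b * (b + 1) ^ k := by
    intro k
    induction k with
    | zero => simp
    | succ k ih =>
      calc b ^ (k + 1) * (b + (k + 1)) ≤ b ^ k * (b + k) * (b + 1) := by
            have : b * (b + (k + 1)) ≤ (b + k) * (b + 1) := by nlinarith
            calc b ^ (k + 1) * (b + (k + 1)) = b ^ k * (b * (b + (k + 1))) := by ring
              _ ≤ b ^ k * ((b + k) * (b + 1)) := Nat.mul_le_mul_left _ this
              _ = _ := by ring
        _ ≤ b * (b + 1) ^ k * (b + 1) := Nat.mul_le_mul_right _ ih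
        _ = b * (b + 1) ^ (k + 1) := by ring
  have h1 := key (b + 1)
  refine le_of_mul_le_mul_left ?_ hb
  refine le_trans ?_ h1
  calc b * (2 * b ^ (b + 1)) = b ^ (b + 1) * (2 * b) := by ring
    _ ≤ b ^ (b + 1) * (b + (b + 1)) := Nat.mul_le_mul_left _ (by omega)

/-- If every step removes at least an `a`-th part of the set, then `a * m` steps exhaust a set of
less than `2 ^ m` elements. -/
theorem iterate_eq_empty {V : Type*} {f : Finset V → Finset V} {P : Finset V → Prop} {a m : ℕ}
    (ha : 1 ≤ a) (hP : ∀ U, P U → P (f U)) (hf : ∀ U, P U → U.card + a * (f U).card ≤ a * U.card)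
    {U : Finset V} (hU : P U) (hm : U.card < 2 ^ m) : f^[a * m] U = ∅ := by
  obtain ⟨b, rfl⟩ : ∃ b, a = b + 1 := ⟨a - 1, by omega⟩
  have key : ∀ k, P (f^[k] U) ∧ (b + 1) ^ k * (f^[k] U).card ≤ b ^ k * U.card := by
    intro k
    induction k with
    | zero => simpa using hU
    | succ k ih =>
      rw [Function.iterate_succ_apply']
      refine ⟨hP _ ih.1, ?_⟩
      have h1 := hf _ ih.1
      have h2 : (b + 1) * (f (f^[k] U)).card ≤ b * (f^[k] U).card := by nlinarith
      calc (b + 1) ^ (k + 1) * (f (f^[k] U)).card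
          = (b + 1) ^ k * ((b + 1) * (f (f^[k] U)).card) := by ring
        _ ≤ (b + 1) ^ k * (b * (f^[k] U).card) := Nat.mul_le_mul_left _ h2
        _ = b * ((b + 1) ^ k * (f^[k] U).card) := by ring
        _ ≤ b * (b ^ k * U.card) := Nat.mul_le_mul_left _ ih.2
        _ = b ^ (k + 1) * U.card := by ring
  have h1 := (key ((b + 1) * m)).2
  by_contra hne
  have hpos : 1 ≤ (f^[(b + 1) * m] U).card :=
    Finset.card_pos.2 (Finset.nonempty_iff_ne_empty.2 hne)
  have h2 : (2 * b ^ (b + 1)) ^ m ≤ ((b + 1) ^ (b + 1)) ^ m :=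
    Nat.pow_le_pow_left (two_mul_pow_le b) m
  rw [mul_pow, ← pow_mul, ← pow_mul] at h2
  have h3 : (b + 1) ^ ((b + 1) * m) ≤ b ^ ((b + 1) * m) * U.card :=
    le_trans (Nat.le_mul_of_pos_right _ hpos) h1
  have h4 : 0 < (b + 1) ^ ((b + 1) * m) := by positivity
  have h5 : 0 < b ^ ((b + 1) * m) := by
    by_contra h0
    have : b ^ ((b + 1) * m) = 0 := by omega
    rw [this] at h3
    omega
  have h6 : b ^ ((b + 1) * m) * U.card < b ^ ((b + 1) * m) * 2 ^ m :=
    Nat.mul_lt_mul_of_pos_left hm h5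
  have h7 : 2 ^ m * b ^ ((b + 1) * m) = b ^ ((b + 1) * m) * 2 ^ m := mul_comm _ _
  omega

/-- Since `2 * 14 ^ 11 ≤ 15 ^ 11`, eleven steps of growth by `15 / 14` double a ball; `11` is the
least such exponent. This fixes the radius `R = 11 * m`. -/
theorem pow_growth {m n : ℕ} (h : n < 2 ^ m) : 14 ^ (11 * m) * n < 15 ^ (11 * m) := by
  rw [pow_mul, pow_mul]
  calc (14 ^ 11) ^ m * n < (14 ^ 11) ^ m * 2 ^ m :=
        Nat.mul_lt_mul_of_pos_left h (by positivity)
    _ = (14 ^ 11 * 2) ^ m := (mul_pow _ _ _).symm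
    _ ≤ (15 ^ 11) ^ m := Nat.pow_le_pow_left (by norm_num) m

variable {V : Type*} [DecidableEq V] {C : Type*} [Nonempty C] {G : SimpleGraph V} {ν : V → ℕ}
  {d m : ℕ} {U : Finset V}

theorem card_add_mul_card_peel_le {a R : ℕ} (h : U.card ≤ a * (happy C G d R U).card) :
    U.card + a * (peel C G ν d R m U).card ≤ a * U.card := by
  have h1 := Finset.card_sdiff_add_card_eq_card (removed_subset (C := C) (G := G) (ν := ν) (d := d)
    (R := R) (m := m) (U := U))
  have h2 := Finset.card_le_card (happy_subset_removed (C := C) (G := G) (ν := ν) (d := d)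
    (R := R) (m := m) (U := U))
  have h3 : U.card ≤ a * (removed C G ν d R m U).card := h.trans (Nat.mul_le_mul_left _ h2)
  unfold peel
  rw [← h1] at h3 ⊢
  nlinarith

/-- The number of phases in a graph of maximum degree at most `d`. -/
theorem iterate_peel_eq_empty_of_degree_le (hd : 3 ≤ d) (hU : U.card < 2 ^ m)
    (hK : ∀ Q ⊆ U, ¬ G.IsNClique (d + 1) Q) (hdeg : ∀ u ∈ U, degreeIn G U u ≤ d) :
    (peel C G ν d (11 * m) m)^[9 * d * m] U = ∅ := by
  refine iterate_eq_empty (P := fun W => W ⊆ U) (by omega)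
    (fun W hW => peel_subset.trans hW) (fun W hW => card_add_mul_card_peel_le ?_) subset_rfl hU
  exact card_le_happy_of_degree_le hd (fun Q hQ => hK Q (hQ.trans hW))
    (pow_growth ((Finset.card_le_card hW).trans_lt hU))
    (fun u hu => (degreeIn_mono hW u).trans (hdeg u (hW hu)))

/-- The number of phases in a graph of maximum average degree at most `d`. -/
theorem iterate_peel_eq_empty (hd : 3 ≤ d) (hU : U.card < 2 ^ m)
    (hK : ∀ Q ⊆ U, ¬ G.IsNClique (d + 1) Q)
    (hmad : ∀ W ⊆ U, ∑ u ∈ W, degreeIn G W u ≤ d * W.card) :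
    (peel C G ν d (11 * m) m)^[14 * d ^ 2 * m] U = ∅ := by
  refine iterate_eq_empty (P := fun W => W ⊆ U) (by nlinarith)
    (fun W hW => peel_subset.trans hW) (fun W hW => card_add_mul_card_peel_le ?_) subset_rfl hU
  exact card_le_happy hd (fun Q hQ => hK Q (hQ.trans hW))
    (pow_growth ((Finset.card_le_card hW).trans_lt hU)) (hmad W hW)

end PhaseCount

/-! ### Views and the algorithm that gathers them -/

/-- What a vertex knows: initially the number of vertices, its identifier and its input, and later
on its previous knowledge and that of its neighbors, by their identifiers. -/
inductive View (I : Type u) : Type u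
  | leaf (n i : ℕ) (x : I) : View I
  | node (self : View I) (neighbors : Set ℕ) (child : ℕ → View I) : View I

namespace View

variable {I : Type u}

def size : View I → ℕ
  | leaf n _ _ => n
  | node s _ _ => s.size

def ident : View I → ℕ
  | leaf _ i _ => i
  | node s _ _ => s.ident

def depth : View I → ℕ
  | leaf _ _ _ => 0
  | node s _ _ => s.depth + 1

end View

open scoped Classical in
/-- The knowledge of the vertex `v` after `t` rounds, on a graph on `Fin n` with identifiers
`1, …, n` and inputs `x`. -/
noncomputable def view {I : Type u} {n : ℕ} (G : SimpleGraph (Fin n)) (x : Fin n → I) :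
    ℕ → Fin n → View I
  | 0, v => .leaf n (v + 1) (x v)
  | t + 1, v => .node (view G x t v) {i | ∃ w, G.Adj v w ∧ (w : ℕ) + 1 = i} fun i =>
      -- The default value away from the neighbors is the one used in `gather`, so that its states
      -- are literally the views.
      if h : ∃ w, G.Adj v w ∧ (w : ℕ) + 1 = i then view G x t h.choose else view G x t v

section View

variable {I O : Type u} {n : ℕ} {G G' : SimpleGraph (Fin n)} {x x' : Fin n → I}

theorem size_view (t : ℕ) (v : Fin n) : (view G x t v).size = n := by
  induction t with
  | zero => rfl
  | succ t ih => exact ih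

theorem ident_view (t : ℕ) (v : Fin n) : (view G x t v).ident = v + 1 := by
  induction t with
  | zero => rfl
  | succ t ih => exact ih

theorem depth_view (t : ℕ) (v : Fin n) : (view G x t v).depth = t := by
  induction t with
  | zero => rfl
  | succ t ih => exact congrArg (· + 1) ih

theorem input_eq_of_view_eq {v : Fin n} (h : view G x 0 v = view G' x' 0 v) : x v = x' v := by
  simpa [view] using h

/-- Vertices with the same views see the same graph around them. -/
theorem zone_view (G G' : SimpleGraph (Fin n)) (x x' : Fin n → I) :
    Zone G G' fun r => {v | view G x r v = view G' x' r v} := by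
  have hsucc : ∀ {r v}, view G x (r + 1) v = view G' x' (r + 1) v →
      view G x r v = view G' x' r v ∧ (∀ w, G.Adj v w ↔ G'.Adj v w) ∧
        ∀ w, G.Adj v w → view G x r w = view G' x' r w := by
    intro r v h
    simp only [view, View.node.injEq] at h
    obtain ⟨h1, h2, h3⟩ := h
    have hex : ∀ (H : SimpleGraph (Fin n)) (w : Fin n), (∃ u, H.Adj v u ∧ (u : ℕ) + 1 = w + 1) ↔
        H.Adj v w := by
      intro H w
      constructor
      · rintro ⟨u, hu, e⟩
        rwa [← Fin.ext (Nat.succ_injective e)]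
      · exact fun hw => ⟨w, hw, rfl⟩
    have hadj : ∀ w, G.Adj v w ↔ G'.Adj v w := by
      intro w
      have := Set.ext_iff.1 h2 ((w : ℕ) + 1)
      simp only [Set.mem_ofPred_eq] at this
      rwa [hex, hex] at this
    refine ⟨h1, hadj, fun w hw => ?_⟩
    have e := congrFun h3 ((w : ℕ) + 1)
    have hG := (hex G w).2 hw
    have hG' := (hex G' w).2 ((hadj w).1 hw)
    rw [dif_pos hG, dif_pos hG'] at e
    rwa [Fin.ext (Nat.succ_injective hG.choose_spec.2),
      Fin.ext (Nat.succ_injective hG'.choose_spec.2)] at e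
  exact ⟨antitone_nat_of_succ_le fun r v hv => (hsucc hv).1, fun hv => (hsucc hv).2.1,
    fun hv hvw => (hsucc hv).2.2 _ hvw⟩

/-- The value of `f` at `v` is determined by what `v` sees within `t` rounds. -/
def Determined (f : ∀ n, SimpleGraph (Fin n) → (Fin n → I) → Fin n → O)
    (G : SimpleGraph (Fin n)) (x : Fin n → I) (t : ℕ) (v : Fin n) : Prop :=
  ∀ (G' : SimpleGraph (Fin n)) (x' : Fin n → I), view G x t v = view G' x' t v →
    f n G x v = f n G' x' v

/-- The output `o` is the value of `f` in every network that is consistent with the view `s`. -/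
def IsForced (f : ∀ n, SimpleGraph (Fin n) → (Fin n → I) → Fin n → O) (s : View I) (o : O) :
    Prop :=
  ∀ (n : ℕ) (G : SimpleGraph (Fin n)) (x : Fin n → I) (t : ℕ) (v : Fin n),
    s = view G x t v → f n G x v = o

/-- A view records the number of vertices, the number of rounds and the identifier. A network
consistent with it is therefore a graph on the same `Fin n`, seen from the same vertex at the same
time. -/
theorem Determined.isForced {f : ∀ n, SimpleGraph (Fin n) → (Fin n → I) → Fin n → O} {t : ℕ}
    {v : Fin n} (h : Determined f G x t v) : IsForced f (view G x t v) (f n G x v) := by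
  intro n' G' x' t' v' e
  have h1 := congrArg View.size e
  rw [size_view, size_view] at h1
  subst h1
  have h2 := congrArg View.depth e
  rw [depth_view, depth_view] at h2
  subst h2
  have h3 := congrArg View.ident e
  rw [ident_view, ident_view] at h3
  have h4 : v = v' := Fin.ext (Nat.succ_injective h3)
  subst h4
  exact (h G' x' e).symm

open scoped Classical in
/-- The algorithm that gathers all information, until it determines the value of `f`. -/
noncomputable def gather (f : ∀ n, SimpleGraph (Fin n) → (Fin n → I) → Fin n → O) :
    LocalAlgorithm I O where
  State := View I
  Message := View I
  init := View.leaf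
  send := id
  receive s M := .node s {i | ∃ y ∈ M, y.ident = i} fun i =>
    if h : ∃ y ∈ M, y.ident = i then h.choose else s
  output s := if h : ∃ o, IsForced f s o then some h.choose else none

/-- Distinct identifiers let a vertex sort the received multiset into a family indexed by
identifiers without loss. -/
theorem gather_stateAfter (f : ∀ n, SimpleGraph (Fin n) → (Fin n → I) → Fin n → O)
    {V : Type v} [Fintype V] (G : SimpleGraph V) [DecidableRel G.Adj] (ident : V → ℕ)
    (input : V → I) (e : V ≃ Fin (Fintype.card V)) (he : ∀ w, ident w = e w + 1) (t : ℕ) (w : V) :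
    (gather f).stateAfter G ident input t w =
      view (G.comap e.symm) (input ∘ e.symm) t (e w) := by
  induction t generalizing w with
  | zero => simp [LocalAlgorithm.stateAfter, gather, view, he]
  | succ t ih =>
    have hM : ∀ y : View I, y ∈ (G.neighborFinset w).val.map (fun z =>
        (gather f).send ((gather f).stateAfter G ident input t z)) ↔
        ∃ a, (G.comap e.symm).Adj (e w) a ∧
          view (G.comap e.symm) (input ∘ e.symm) t a = y := by
      intro y
      refine Multiset.mem_map.trans ?_
      constructor
      · rintro ⟨z, hz, rfl⟩
        refine ⟨e z, ?_, (ih z).symm⟩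
        simpa using hz
      · rintro ⟨a, ha, rfl⟩
        refine ⟨e.symm a, by simpa using ha, ?_⟩
        have := ih (e.symm a)
        rw [e.apply_symm_apply] at this
        exact this
    have hex : ∀ i, (∃ y ∈ (G.neighborFinset w).val.map (fun z =>
        (gather f).send ((gather f).stateAfter G ident input t z)), View.ident y = i) ↔
        ∃ a, (G.comap e.symm).Adj (e w) a ∧ (a : ℕ) + 1 = i := by
      intro i
      constructor
      · rintro ⟨y, hy, rfl⟩
        obtain ⟨a, ha, rfl⟩ := (hM y).1 hy
        exact ⟨a, ha, (ident_view _ _).symm⟩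
      · rintro ⟨a, ha, rfl⟩
        exact ⟨_, (hM _).2 ⟨a, ha, rfl⟩, ident_view _ _⟩
    simp only [LocalAlgorithm.stateAfter, view]
    rw [ih w]
    simp only [gather]
    congr 1
    · ext i
      exact hex i
    · funext i
      by_cases h : ∃ a, (G.comap e.symm).Adj (e w) a ∧ (a : ℕ) + 1 = i
      · have h' := (hex i).2 h
        refine (dif_pos h').trans (Eq.trans ?_ (dif_pos h).symm)
        obtain ⟨a, -, ha⟩ := (hM _).1 h'.choose_spec.1
        have h1 := h'.choose_spec.2
        have h2 : (h.choose : ℕ) + 1 = i := h.choose_spec.2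
        rw [← ha, ident_view, ← h2] at h1
        rw [← Fin.ext (Nat.succ_injective h1)]
        exact ha.symm
      · have h' := mt (hex i).1 h
        rw [dif_neg h]
        exact dif_neg h'

/-- A vertex stops at the first time when its view forces a value, at the latest at time `T`. The
actual network is consistent with the view, so the forced value is that of `f`; the outputs do not
depend on the bound `T`. -/
theorem gather_computesWithin (f : ∀ n, SimpleGraph (Fin n) → (Fin n → I) → Fin n → O)
    {V : Type v} [Fintype V] (G : SimpleGraph V) [DecidableRel G.Adj] (ident : V → ℕ)
    (input : V → I) (e : V ≃ Fin (Fintype.card V)) (he : ∀ w, ident w = e w + 1) {r : ℝ} {T : ℕ}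
    (hT : (T : ℝ) ≤ r)
    (h : ∀ v, Determined f (G.comap e.symm) (input ∘ e.symm) T v) :
    (gather f).ComputesWithin G ident input
      (fun w => f _ (G.comap e.symm) (input ∘ e.symm) (e w)) r := by
  classical
  intro w
  have hex : ∃ t, ∃ o, IsForced f ((gather f).stateAfter G ident input t w) o :=
    ⟨T, _, by rw [gather_stateAfter f G ident input e he]; exact (h (e w)).isForced⟩
  have hle : Nat.find hex ≤ T := Nat.find_min' hex
    ⟨_, by rw [gather_stateAfter f G ident input e he]; exact (h (e w)).isForced⟩
  refine ⟨Nat.find hex, le_trans (by exact_mod_cast hle) hT, ?_, fun s hs => ?_⟩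
  · have h1 := Nat.find_spec hex
    refine (dif_pos h1).trans (congrArg some ?_)
    exact (h1.choose_spec _ _ _ _ _ (gather_stateAfter f G ident input e he _ w)).symm
  · exact dif_neg (Nat.find_min hex hs)

end View

/-! ### Degree sums, and transport along a renumbering -/

section Transfer

variable {V : Type v} {G : SimpleGraph V}

/-- The bound on the average degree of the subgraph induced by `W`, with twice its number of edges
written as a degree sum. -/
theorem sum_degreeIn_le_of_mad_le [Fintype V] {d : ℕ} (h : mad G ≤ d) (W : Finset V) :
    ∑ u ∈ W, degreeIn G W u ≤ d * W.card := by
  classical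
  let H : G.Subgraph :=
    { verts := W
      Adj := (restrict G W).Adj
      adj_sub := fun h => h.1
      edge_vert := fun h => h.2.1
      symm := (restrict G W).symm }
  have h1 : (H.edgeSet.ncard : ℕ) = (restrict G W).edgeFinset.card := by
    rw [← Set.ncard_coe_finset, SimpleGraph.coe_edgeFinset]
    congr 1
  have h2 : ∑ u ∈ W, degreeIn G W u = 2 * (restrict G W).edgeFinset.card := by
    rw [← SimpleGraph.sum_degrees_eq_twice_card_edges, ← Finset.sum_subset (Finset.subset_univ W)]
    · refine Finset.sum_congr rfl fun u hu => ?_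
      unfold degreeIn
      rw [← SimpleGraph.card_neighborFinset_eq_degree]
      congr 1
      ext w
      rw [Finset.mem_filter, SimpleGraph.mem_neighborFinset]
      exact ⟨fun h => ⟨h.2, hu, h.1⟩, fun h => ⟨h.2.2, h.1⟩⟩
    · intro u _ hu
      rw [SimpleGraph.degree_eq_zero_iff_notMem_support]
      rintro ⟨w, hw⟩
      exact hu hw.2.1
  have h3 := (averageDegree_le_mad G H).trans h
  unfold averageDegree at h3
  have h4 : H.verts.ncard = W.card := Set.ncard_coe_finset W
  rw [h1, h4] at h3
  rcases W.eq_empty_or_nonempty with rfl | hW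
  · simp
  · have hpos : (0 : ℝ) < W.card := by exact_mod_cast Finset.card_pos.2 hW
    rw [div_le_iff₀ hpos] at h3
    rw [h2]
    exact_mod_cast h3

theorem degreeIn_comap {W : Type*} (f : W ↪ V) (B : Finset W) (u : W) :
    degreeIn (G.comap f) B u = degreeIn G (B.map f) (f u) := by
  classical
  unfold degreeIn
  rw [Finset.filter_map, Finset.card_map]
  congr 1

theorem isNClique_map_of_comap {W : Type*} (f : W ↪ V) {Q : Finset W} {k : ℕ}
    (h : (G.comap f).IsNClique k Q) : G.IsNClique k (Q.map f) := by
  refine ⟨?_, by rw [Finset.card_map]; exact h.2⟩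
  rw [SimpleGraph.isClique_iff]
  intro a ha b hb hab
  rw [Finset.coe_map] at ha hb
  obtain ⟨a, ha, rfl⟩ := ha
  obtain ⟨b, hb, rfl⟩ := hb
  exact h.1 ha hb (fun e => hab (by rw [e]))

end Transfer

/-! ### Cliques, the output function and the round bounds -/

open scoped Classical in
/-- The cliques on `k` vertices that contain `v`. -/
noncomputable def cliquesAt {V : Type*} [Fintype V] (G : SimpleGraph V) (k : ℕ) (v : V) :
    Finset (Finset V) :=
  Finset.univ.filter fun Q => v ∈ Q ∧ G.IsNClique k Q

theorem mem_cliquesAt {V : Type*} [Fintype V] {G : SimpleGraph V} {k : ℕ} {v : V}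
    {Q : Finset V} : Q ∈ cliquesAt G k v ↔ v ∈ Q ∧ G.IsNClique k Q := by
  classical
  simp [cliquesAt]

theorem isNClique_of_adj_iff {V : Type*} {G G' : SimpleGraph V} {Q : Finset V} {k : ℕ}
    (h : ∀ u ∈ Q, ∀ w, G.Adj u w → G'.Adj u w) (hQ : G.IsNClique k Q) : G'.IsNClique k Q :=
  ⟨fun a ha b hb hab => h a ha b (hQ.1 ha hb hab), hQ.2⟩

/-- A clique through `v` lies in the closed neighborhood of `v`, and two levels of the zone fix all
edges at these vertices. -/
theorem Zone.cliquesAt_eq {V : Type*} [Fintype V] {G G' : SimpleGraph V} {S : ℕ → Set V}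
    (h : Zone G G' S) {k : ℕ} {v : V} (hv : v ∈ S 2) : cliquesAt G k v = cliquesAt G' k v := by
  have h1 := h.antitone (Nat.le_succ 1) hv
  have key : ∀ w, w = v ∨ G.Adj v w → w ∈ S 1 := by
    rintro w (rfl | hw)
    · exact h1
    · exact h.step (r := 1) hv hw
  ext Q
  rw [mem_cliquesAt, mem_cliquesAt]
  refine and_congr_right fun hvQ => ⟨fun hQ => ?_, fun hQ => ?_⟩
  · refine isNClique_of_adj_iff (fun u hu w huw => ?_) hQ
    refine (h.adj_iff (r := 0) (key u ?_) w).1 huw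
    by_cases huv : u = v
    · exact Or.inl huv
    · exact Or.inr (hQ.1 hvQ hu (Ne.symm huv))
  · refine isNClique_of_adj_iff (fun u hu w huw => ?_) hQ
    refine (h.adj_iff (r := 0) (key u ?_) w).2 huw
    by_cases huv : u = v
    · exact Or.inl huv
    · exact Or.inr ((h.adj_iff (r := 1) hv u).2 (hQ.1 hvQ hu (Ne.symm huv)))

open scoped Classical in
/-- The vertices in no clique on `d + 1` vertices. -/
noncomputable def cliqueFree {V : Type*} [Fintype V] (G : SimpleGraph V) (d : ℕ) : Finset V :=
  Finset.univ.filter fun v => cliquesAt G (d + 1) v = ∅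

/-- The length of the binary representation of `n`. -/
def bits (n : ℕ) : ℕ := Nat.log 2 n + 1

section Result

variable {C : Type u}

/-- The coloring of the vertices in no clique on `d + 1` vertices. -/
noncomputable def sparseColoring (n d : ℕ) (G : SimpleGraph (Fin n)) (L : Fin n → Finset C) :
    Fin n → Option C :=
  coloring G Fin.val d (11 * bits n) (bits n) L (14 * d ^ 2 * bits n) (cliqueFree G d)

/-- The output of a vertex for the parameter `d`. -/
noncomputable def result (n d : ℕ) (G : SimpleGraph (Fin n)) (L : Fin n → Finset C) (v : Fin n) :
    ColorOrClique C :=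
  -- For `n ≤ 1` the round bound is `0`, so the output must come from the list alone. The value
  -- `.clique ∅` is a default that does not occur under the assumptions of the theorem.
  if n ≤ 1 then (pick (L v)).elim (.clique ∅) .color
  else (pick (cliquesAt G (d + 1) v)).elim
    ((sparseColoring n d G L v).elim (.clique ∅) .color)
    fun Q => .clique (Q.image fun w : Fin n => (w : ℕ) + 1)

theorem lt_two_pow_bits (n : ℕ) : n < 2 ^ bits n := Nat.lt_pow_succ_log_self (by norm_num) n

theorem bits_pos (n : ℕ) : 1 ≤ bits n := Nat.le_add_left _ _

theorem mem_cliqueFree {V : Type*} [Fintype V] {G : SimpleGraph V} {d : ℕ} {v : V} :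
    v ∈ cliqueFree G d ↔ cliquesAt G (d + 1) v = ∅ := by
  simp [cliqueFree]

theorem not_isNClique_of_subset_cliqueFree {V : Type*} [Fintype V] {G : SimpleGraph V} {d : ℕ}
    {Q : Finset V} (hQ : Q ⊆ cliqueFree G d) : ¬ G.IsNClique (d + 1) Q := by
  intro h
  obtain ⟨v, hv⟩ : Q.Nonempty := Finset.card_pos.1 (by rw [h.2]; omega)
  have := mem_cliqueFree.1 (hQ hv)
  exact Finset.notMem_empty Q (this ▸ mem_cliquesAt.2 ⟨hv, h⟩)

/-- The radius depends on a number `k` of phases that exhausts this particular network, not on the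
fixed number of phases in `sparseColoring`. Two more rounds decide which vertices lie in cliques. -/
theorem determined_result {n d k : ℕ} {G : SimpleGraph (Fin n)}
    {x : Fin n → ℕ × Finset C} {v : Fin n} (hd : (x v).1 = d)
    (hk : (peel C G Fin.val d (11 * bits n) (bits n))^[k] (cliqueFree G d) = ∅) :
    Determined (fun n G x v => result n (x v).1 G (fun w => (x w).2) v) G x
      (k * (2 * phaseRadius d (11 * bits n) (bits n)) + 2) v := by
  intro G' x' h
  have hZ := zone_view G G' x x'
  have h0 : x v = x' v := input_eq_of_view_eq (hZ.antitone (Nat.zero_le _) h)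
  have h2 : cliquesAt G (d + 1) v = cliquesAt G' (d + 1) v :=
    hZ.cliquesAt_eq (hZ.antitone (Nat.le_add_left _ _) h)
  have h3 : sparseColoring n d G (fun w => (x w).2) v =
      sparseColoring n d G' (fun w => (x' w).2) v := by
    refine (hZ.shift 2).coloring_eq (fun w hw => ?_) (fun w hw => ?_) hk _ h
    · rw [input_eq_of_view_eq (hZ.antitone (Nat.zero_le _) hw)]
    · rw [mem_cliqueFree, mem_cliqueFree, hZ.cliquesAt_eq (by simpa using hw)]
  simp only [result]
  rw [← h0, hd, h2, h3]

theorem determined_result_of_le_one {n : ℕ} (hn : n ≤ 1) {G : SimpleGraph (Fin n)}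
    {x : Fin n → ℕ × Finset C} {v : Fin n} :
    Determined (fun n G x v => result n (x v).1 G (fun w => (x w).2) v) G x 0 v := by
  intro G' x' h
  have h0 : x v = x' v := input_eq_of_view_eq h
  simp only [result]
  rw [if_pos hn, if_pos hn, h0]

theorem phaseRadius_le {d m : ℕ} (hd : 3 ≤ d) (hm : 1 ≤ m) :
    phaseRadius d (11 * m) m ≤ 84 * (d * m ^ 2) := by
  have h1 : m ≤ m ^ 2 := by nlinarith
  have h2 : 3 * m ^ 2 ≤ d * m ^ 2 := Nat.mul_le_mul_right _ hd
  have h3 : d * m ≤ d * m ^ 2 := Nat.mul_le_mul_left _ h1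
  have h4 : d ≤ d * m := Nat.le_mul_of_pos_right _ hm
  have e : phaseRadius d (11 * m) m =
      22 * (d * m ^ 2) + 66 * m ^ 2 + 3 * (d * m) + 49 * m + d + 4 := by
    unfold phaseRadius scheduleRadius
    ring
  omega

/-- `bits n * log 2 ≤ log n + log 2 ≤ 2 * log n`, and `2 / log 2 < 3`. -/
theorem bits_le {n : ℕ} (hn : 2 ≤ n) : (bits n : ℝ) ≤ 3 * Real.log n := by
  have h1 : (2 : ℝ) ^ Nat.log 2 n ≤ n := by exact_mod_cast Nat.pow_log_le_self 2 (by omega)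
  have h2 := Real.log_le_log (by positivity) h1
  rw [Real.log_pow] at h2
  have h3 : Real.log 2 ≤ Real.log n := Real.log_le_log (by norm_num) (by exact_mod_cast hn)
  have h4 := Real.log_two_gt_d9
  have h5 : (bits n : ℝ) = Nat.log 2 n + 1 := by simp [bits]
  have h6 : (bits n : ℝ) * Real.log 2 ≤ 2 * Real.log n := by rw [h5]; linarith
  have h7 : (0 : ℝ) ≤ bits n := Nat.cast_nonneg _
  nlinarith

/-- The factor `168` is twice the `84` of `phaseRadius_le`, and `27 = 3 ^ 3` comes from `bits_le`.
-/
theorem rounds_le {n a b D : ℕ} (hn : 2 ≤ n) {d : ℕ} (hd : 3 ≤ d)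
    (hb : a * d * 168 + 2 ≤ b * D) :
    ((a * bits n * (2 * phaseRadius d (11 * bits n) (bits n)) + 2 : ℕ) : ℝ) ≤
      (27 * b : ℝ) * D * Real.log n ^ 3 := by
  have hm := bits_pos n
  have h1 : a * bits n * (2 * phaseRadius d (11 * bits n) (bits n)) + 2 ≤
      b * D * bits n ^ 3 := by
    have h2 := Nat.mul_le_mul_left (a * bits n) (Nat.mul_le_mul_left 2 (phaseRadius_le hd hm))
    have h3 : a * bits n * (2 * (84 * (d * bits n ^ 2))) = a * d * 168 * bits n ^ 3 := by ring
    have h4 := Nat.mul_le_mul_right (bits n ^ 3) hb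
    have h5 : 1 ≤ bits n ^ 3 := Nat.one_le_pow _ _ hm
    rw [Nat.add_mul] at h4
    omega
  have h2 : (bits n : ℝ) ^ 3 ≤ (3 * Real.log n) ^ 3 :=
    pow_le_pow_left₀ (Nat.cast_nonneg _) (bits_le hn) 3
  calc ((a * bits n * (2 * phaseRadius d (11 * bits n) (bits n)) + 2 : ℕ) : ℝ)
      ≤ ((b * D * bits n ^ 3 : ℕ) : ℝ) := by exact_mod_cast h1
    _ = (b : ℝ) * D * (bits n : ℝ) ^ 3 := by push_cast; ring
    _ ≤ (b : ℝ) * D * (3 * Real.log n) ^ 3 := by gcongr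
    _ = (27 * b : ℝ) * D * Real.log n ^ 3 := by ring

/-- The vertices outside of all cliques are colored in any case. If there are no others, this colors
the graph; otherwise some vertex reports a clique, and the colors are not needed. -/
theorem findsClique_or_findsListColoring {n d : ℕ} (hn : 1 < n) {G : SimpleGraph (Fin n)}
    {L : Fin n → Finset C} (hL : ∀ v, d ≤ (L v).card)
    (hk : (peel C G Fin.val d (11 * bits n) (bits n))^[14 * d ^ 2 * bits n] (cliqueFree G d) = ∅) :
    FindsClique G (fun w => (w : ℕ) + 1) (d + 1) (result n d G L) ∨
      FindsListColoring G L (result n d G L) := by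
  have hcol : IsPartialColoring G L (cliqueFree G d) (sparseColoring n d G L) :=
    coloring_spec Fin.val_injective (fun v => v.2.trans (lt_two_pow_bits n)) (bits_pos n) _
      (fun v _ => hL v) hk
  have h1 : ∀ v ∈ cliqueFree G d, ∃ c, sparseColoring n d G L v = some c ∧
      result n d G L v = .color c := by
    intro v hv
    obtain ⟨c, hc⟩ := Option.ne_none_iff_exists'.1 ((hcol.ne_none_iff v).2 hv)
    refine ⟨c, hc, ?_⟩
    rw [result, if_neg (by omega), pick_eq_none.2 (mem_cliqueFree.1 hv), Option.elim_none, hc,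
      Option.elim_some]
  have h2 : ∀ v ∉ cliqueFree G d, ∃ Q ∈ cliquesAt G (d + 1) v,
      result n d G L v = .clique (Q.image fun w : Fin n => (w : ℕ) + 1) := by
    intro v hv
    obtain ⟨Q, hQ⟩ := Option.ne_none_iff_exists'.1
      (mt (fun h => mem_cliqueFree.2 (pick_eq_none.1 h)) hv)
    exact ⟨Q, mem_of_pick_eq hQ, by rw [result, if_neg (by omega), hQ, Option.elim_some]⟩
  by_cases hall : ∀ v, v ∈ cliqueFree G d
  · right
    choose c hc hres using fun v => h1 v (hall v)
    exact ⟨SimpleGraph.Coloring.mk c fun {u w} huw e =>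
      hcol.proper u w _ huw (hc u) (e ▸ hc w), fun w => ⟨hcol.mem_list w _ (hc w), hres w⟩⟩
  · left
    push Not at hall
    obtain ⟨v, hv⟩ := hall
    obtain ⟨Q, -, hQ⟩ := h2 v hv
    refine ⟨⟨v, _, hQ⟩, fun w S hw => ?_⟩
    by_cases hwU : w ∈ cliqueFree G d
    · obtain ⟨c, -, hc⟩ := h1 w hwU
      rw [hc] at hw
      cases hw
    · obtain ⟨Q, hQ, hres⟩ := h2 w hwU
      rw [hres] at hw
      obtain ⟨h3, h4⟩ := mem_cliquesAt.1 hQ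
      exact ⟨Q, h4, h3, ColorOrClique.clique.inj hw⟩

theorem findsListColoring_of_le_one {n d : ℕ} (hn : n ≤ 1) (hd : 3 ≤ d) {G : SimpleGraph (Fin n)}
    {L : Fin n → Finset C} (hL : ∀ v, d ≤ (L v).card) :
    FindsListColoring G L (result n d G L) := by
  have h : ∀ v, ∃ c, pick (L v) = some c := fun v =>
    Option.ne_none_iff_exists'.1 (mt pick_eq_none.1 (Finset.nonempty_iff_ne_empty.1
      (Finset.card_pos.1 (by have := hL v; omega))))
  choose c hc using h
  refine ⟨SimpleGraph.Coloring.mk c fun {u w} huw => ?_, fun w => ⟨mem_of_pick_eq (hc w), ?_⟩⟩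
  · exact (huw.ne (Fin.ext (by omega))).elim
  · rw [result, if_pos hn, hc, Option.elim_some]
    rfl

variable {V W : Type*} [Fintype V] [Fintype W] {G : SimpleGraph V} {ident : V → ℕ} {k : ℕ}

theorem FindsClique.of_comap (e : V ≃ W) {ident' : W → ℕ} (he : ∀ v, ident v = ident' (e v))
    {out : W → ColorOrClique C} (h : FindsClique (G.comap e.symm) ident' k out) :
    FindsClique G ident k (fun v => out (e v)) := by
  classical
  obtain ⟨⟨w, S, hS⟩, h2⟩ := h
  refine ⟨⟨e.symm w, S, by simpa using hS⟩, fun v S hv => ?_⟩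
  obtain ⟨Q, h3, h4, h5⟩ := h2 (e v) S hv
  refine ⟨Q.map e.symm.toEmbedding, isNClique_map_of_comap e.symm.toEmbedding h3,
    Finset.mem_map.2 ⟨e v, h4, e.symm_apply_apply v⟩, ?_⟩
  rw [← h5, Finset.map_eq_image, Finset.image_image]
  exact Finset.image_congr fun w _ => by simp [he]

theorem FindsListColoring.of_comap (e : V ≃ W) {L : V → Finset C} {out : W → ColorOrClique C}
    (h : FindsListColoring (G.comap e.symm) (fun w => L (e.symm w)) out) :
    FindsListColoring G L (fun v => out (e v)) := by
  obtain ⟨c, hc⟩ := h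
  refine ⟨SimpleGraph.Coloring.mk (fun v => c (e v)) fun {u w} huw => c.valid (by simpa using huw),
    fun v => ⟨?_, (hc (e v)).2⟩⟩
  have := (hc (e v)).1
  simp only [e.symm_apply_apply] at this
  exact this

end Result

end LocalColoring

/-! ### Assembly of the theorem -/

open LocalColoring in
theorem theorem1p3 :
    ∃ K : ℝ, ∀ C : Type u, ∃ A : LocalAlgorithm (ℕ × Finset C) (ColorOrClique C),
      ∀ (V : Type v) [Fintype V] (G : SimpleGraph V) [DecidableRel G.Adj]
        (ident : V → ℕ) (d : ℕ) (L : V → Finset C),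
        IsIdentifierAssignment ident →
        max 3 (mad G) ≤ (d : ℝ) →
        (∀ w : V, d ≤ (L w).card) →
        ∃ out : V → ColorOrClique C,
          (FindsClique G ident (d + 1) out ∨ FindsListColoring G L out) ∧
          A.ComputesWithin G ident (fun w => (d, L w)) out
            (K * (d : ℝ) ^ 4 * Real.log (Fintype.card V : ℝ) ^ 3) ∧
          ((∀ w : V, G.degree w ≤ d) →
            A.ComputesWithin G ident (fun w => (d, L w)) out
              (K * (d : ℝ) ^ 2 * Real.log (Fintype.card V : ℝ) ^ 3)) := by
  refine ⟨27 * (2353 : ℕ), fun C =>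
    ⟨gather fun n G x v => result n (x v).1 G (fun w => (x w).2) v, ?_⟩⟩
  intro V _ G _ ident d L hid hd hL
  have hd3 : 3 ≤ d := by exact_mod_cast (le_max_left _ _).trans hd
  have hmad : mad G ≤ d := (le_max_right _ _).trans hd
  -- the vertices are numbered by their identifiers
  obtain ⟨e, he⟩ : ∃ e : V ≃ Fin (Fintype.card V), ∀ w, ident w = e w + 1 := by
    let g : V → Fin (Fintype.card V) := fun w =>
      ⟨ident w - 1, by have := hid.2 w; omega⟩
    have hg : Function.Injective g := by
      intro a b hab
      have h1 := Fin.ext_iff.1 hab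
      have h2 := hid.2 a
      have h3 := hid.2 b
      exact hid.1 (by simp only [g] at h1; omega)
    refine ⟨Equiv.ofBijective g ((Fintype.bijective_iff_injective_and_card g).2 ⟨hg, by simp⟩),
      fun w => ?_⟩
    have := hid.2 w
    simp only [Equiv.ofBijective_apply, g]
    omega
  refine ⟨fun w => result _ d (G.comap e.symm) (fun a => L (e.symm a)) (e w), ?_⟩
  have hcomp : ∀ {r : ℝ} {T : ℕ}, (T : ℝ) ≤ r →
      (∀ v, Determined (fun n G x v => result n (x v).1 G (fun w => (x w).2) v) (G.comap e.symm)
        ((fun w => (d, L w)) ∘ e.symm) T v) →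
      (gather fun n G x v => result n (x v).1 G (fun w => (x w).2) v).ComputesWithin G ident
        (fun w => (d, L w))
        (fun w => result _ d (G.comap e.symm) (fun a => L (e.symm a)) (e w)) r :=
    fun hT h => gather_computesWithin _ G ident _ e he hT h
  have hlog : 0 ≤ Real.log (Fintype.card V) := Real.log_natCast_nonneg _
  -- Here the logarithm vanishes, so every output has to be chosen before any communication.
  by_cases hn : Fintype.card V ≤ 1
  · refine ⟨Or.inr (FindsListColoring.of_comap e
      (findsListColoring_of_le_one hn hd3 fun v => hL _)), hcomp (T := 0) (by rw [Nat.cast_zero]; positivity)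
      fun v => determined_result_of_le_one hn, fun _ => hcomp (T := 0) (by rw [Nat.cast_zero]; positivity)
      fun v => determined_result_of_le_one hn⟩
  have hn1 : 1 < Fintype.card V := by omega
  obtain ⟨v₀⟩ : Nonempty V := Fintype.card_pos_iff.1 (by omega)
  have : Nonempty C := by
    obtain ⟨c, -⟩ : (L v₀).Nonempty := Finset.card_pos.1 (by have := hL v₀; omega)
    exact ⟨c⟩
  have hcard : (cliqueFree (G.comap e.symm) d).card < 2 ^ bits (Fintype.card V) :=
    ((Finset.card_le_univ _).trans (by simp)).trans_lt (lt_two_pow_bits _)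
  have hK := fun Q => not_isNClique_of_subset_cliqueFree (G := G.comap e.symm) (d := d) (Q := Q)
  have hslow : (peel C (G.comap e.symm) Fin.val d (11 * bits (Fintype.card V))
      (bits (Fintype.card V)))^[14 * d ^ 2 * bits (Fintype.card V)]
      (cliqueFree (G.comap e.symm) d) = ∅ := by
    refine iterate_peel_eq_empty hd3 hcard hK fun W _ => ?_
    have h1 := sum_degreeIn_le_of_mad_le hmad (W.map e.symm.toEmbedding)
    rw [Finset.sum_map, Finset.card_map] at h1
    exact (Finset.sum_congr rfl fun u _ => degreeIn_comap e.symm.toEmbedding W u).trans_le h1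
  refine ⟨?_, ?_, fun hdeg => ?_⟩
  · rcases findsClique_or_findsListColoring hn1 (fun v => hL (e.symm v)) hslow with h | h
    · exact Or.inl (FindsClique.of_comap e he h)
    · exact Or.inr (FindsListColoring.of_comap e h)
  -- `14 * 168 = 2352`, and one more absorbs the two rounds for the cliques. The count is of order
  -- `d ^ 3`, so there is room below `d ^ 4`.
  · have hr := rounds_le (n := Fintype.card V) (a := 14 * d ^ 2) (b := 2353) (D := d ^ 4) hn1 hd3
      (by nlinarith [Nat.pow_le_pow_right (show 0 < d by omega) (show 3 ≤ 4 by norm_num),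
        Nat.one_le_pow 4 d (by omega)])
    rw [Nat.cast_pow] at hr
    exact hcomp hr fun v => determined_result rfl hslow
  -- The output function is unchanged; only the number of phases that exhaust the clique-free
  -- vertices drops to `9 * d * bits n`.
  · have hr := rounds_le (n := Fintype.card V) (a := 9 * d) (b := 2353) (D := d ^ 2) hn1 hd3
      (by nlinarith [Nat.one_le_pow 2 d (by omega)])
    rw [Nat.cast_pow] at hr
    refine hcomp hr fun v => determined_result rfl
      (iterate_peel_eq_empty_of_degree_le hd3 hcard hK fun u _ => ?_)
    refine (degreeIn_comap e.symm.toEmbedding _ u).trans_le (le_trans ?_ (hdeg (e.symm u)))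
    unfold degreeIn
    refine Finset.card_le_card fun w hw => ?_
    simp only [Finset.mem_filter] at hw
    exact (G.mem_neighborFinset _ _).2 hw.2
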